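/- Setting. Let $d,N\ge 1$ be integers, $T>0$, $\mathcal X=\{1,\dots,d\}$, let $\Sigma$ be the set of $\mu\in\{0,\tfrac1N,\dots,1\}^d$ with $\sum_x\mu_x=1$, and $\mathscr X=\mathcal X\times\Sigma$. A vector $a\in\mathbb R_+^{d-1}$ of rates out of $x\in\mathcal X$ is indexed by the targets $y\ne x$ in increasing order. Let $\lambda^0,\lambda^1:\mathscr X\to\mathbb R_+^{d-1}$, $\ell:\mathscr X\times\mathbb R_+^{d-1}\to\mathbb R_+$ and $g:\mathscr X\to\mathbb R_+$ be given, where $\ell$ is continuous and, for some $\gamma_\ell>0$ and all $(x,\mu)\in\mathscr X$, $a,a'\in\mathbb R_+^{d-1}$, $\tau\in[0,1]$, satisfies $\tau\ell(x,\mu,a')+(1-\tau)\ell(x,\mu,a)-\ell(x,\mu,\tau a'+(1-\tau)a)\ge\gamma_\ell\,\tau(1-\tau)|a'-a|_2^2$. For functions $\varphi$ on $\mathscr X$ write $|\varphi|_2^2=\sum_{(x,\mu)}|\varphi(x,\mu)|_2^2$, and for $\psi$ continuous on $[0,T]\times\mathscr X$ write $\psi(t)=\psi(t,\cdot)$ and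 $\|\psi\|_{\mathcal S}=\max_{t\in[0,T]}|\psi(t)|_2$. Let $\|f\|_\infty=\sup_{t\in[0,T]}|f(t)|$ for $f:[0,T]\to\mathbb R$. Let $\mathscr A$ be the set of Lipschitz functions $[0,T]\times\mathscr X\to\mathbb R_+^{d-1}$ (admissible controls). For feedback controls $\alpha,\beta:[0,T]\times\mathscr X\to\mathbb R_+^{d-1}$ that are continuous in time, let $\Xi=(X,\mu)$ be the time-inhomogeneous Markov chain on $\mathscr X$ that at time $t$ jumps from $(x,\mu)$ to $(y,\mu)$, $y\ne x$, at rate $\lambda^0_y(x,\mu)+\lambda^1_y(x,\mu)\alpha_y(t,x,\mu)$ and from $(x,\mu)$ to $(x,\mu+\tfrac1N(e_y-e_z))$, $y\ne z$, at rate $N\mu_z\,[\lambda^0_y(z,\mu')+\lambda^1_y(z,\mu')\beta_y(t,z,\mu')]$ with $\mu'=\mu+\tfrac1N(e_x-e_z)$. Put $$J(t,x,\mu,\alpha;\beta)=\mathbb E\Big[\int_t^T\ell(\Xi_u,\alpha(u,\Xi_u))\,du+g(\Xi_T)\,\Big|\,\Xi_t=(x,\mu)\Big],\qquad v^\beta(t,x,\mu)=\inf_{\alpha\in\mathscr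 A}J(t,x,\mu,\alpha;\beta),$$ $$\hat\alpha(x,\mu,p)=\operatorname*{arg\,min}_{a\in\mathbb R_+^{d-1}}\Big\{\ell(x,\mu,a)+\sum_{y\ne x}a_y\lambda^1_y(x,\mu)p_y\Big\},\qquad \alpha^*(\beta)(t,x,\mu)=\hat\alpha\big(x,\mu,(v^\beta(t,y,\mu)-v^\beta(t,x,\mu))_{y\ne x}\big).$$ For $c_a>0$ let $\mathscr A^*_{c_a}=\{\alpha\in\mathscr A:\ |\alpha(t)|_2\le c_a\text{ for all }t\in[0,T]\}$. For $\rho\in(0,1)$, an initial control $\beta^{(0)}=\hat\beta^{(0)}$ and errors $\varepsilon^{(n)}:[0,T]\times\mathscr X\to\mathbb R_+^{d-1}$, $n\ge1$, that are continuous in time, define for $n\ge1$ $$v^{(n)}=v^{\beta^{(n-1)}},\qquad \beta^{(n)}=\rho\beta^{(n-1)}+(1-\rho)\,\alpha^*(\beta^{(n-1)}),$$ $$\hat v^{(n)}=v^{\hat\beta^{(n-1)}},\qquad \hat\beta^{(n)}=\rho\hat\beta^{(n-1)}+(1-\rho)\big(\alpha^*(\hat\beta^{(n-1)})+\varepsilon^{(n)}\big),$$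 $$\gamma^{(n)}(t)=|\hat\beta^{(n)}(t)-\beta^{(n)}(t)|_2^2,\qquad q^{(n)}(t)=|\hat v^{(n)}(t)-v^{(n)}(t)|_2^2 .$$ Theorem. There is a constant $c_0>0$ with $$|\alpha^*(\beta)(t)-\alpha^*(\tilde\beta)(t)|_2\le c_0\,|v^\beta(t)-v^{\tilde\beta}(t)|_2\qquad(\beta,\tilde\beta\in\mathscr A,\ t\in[0,T]),$$ and for every $c_a>0$ there is a constant $c^*>0$ with $$|v^\beta(t)-v^{\tilde\beta}(t)|_2^2\le c^*\int_t^T|\tilde\beta(s)-\beta(s)|_2^2\,ds\qquad(\beta,\tilde\beta\in\mathscr A^*_{c_a},\ t\in[0,T]),$$ such that the following holds for every $\rho\in(0,1)$. Let $\hat c_\rho=2(1-\rho)\max(c_0^2,1)$ and $c_{*,\rho}=c^*\hat c_\rho$. There is a constant $\tilde c>0$ such that for every $\beta^{(0)}\in\mathscr A^*_{c_a}$ and all errors $(\varepsilon^{(n)})_{n\ge1}$ as above, for all $n\ge2$ and $t\in[0,T]$, $$\gamma^{(n-1)}(t)\le\Gamma^{(n-1)}(t):=\hat c_\rho\sum_{k=1}^{n-1}\|\varepsilon^{(n-k)}\|_{\mathcal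 S}^2\sum_{j=1}^k\binom{k-1}{j-1}\rho^{k-j}\frac{c_{*,\rho}^{\,j-1}(T-t)^{j-1}}{(j-1)!},$$ $$q^{(n)}(t)\le Q^{(n)}(t):=\sum_{k=1}^{n-1}\|\varepsilon^{(n-k)}\|_{\mathcal S}^2\sum_{j=1}^k\binom{k-1}{j-1}\rho^{k-j}\frac{c_{*,\rho}^{\,j}(T-t)^{j}}{j!},$$ and $$\sup_{n\ge1}\big(\|\gamma^{(n)}\|_\infty+\|q^{(n)}\|_\infty\big)\le\tilde c\,\sup_{n\ge1}\|\varepsilon^{(n)}\|_{\mathcal S}^2$$ (as an inequality in $[0,\infty]$). -/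

import Mathlib

open Set
open scoped ENNReal

namespace PicardGame

/-- The discretized simplex, in counts: `m x` is the number `N * μ_x` of untagged players in
state `x`; there are `d = k + 1` states and `N` untagged players. -/
def Config (k N : ℕ) : Type :=
  {m : Fin (k + 1) → ℕ // ∑ x, m x = N}

instance instFintypeConfig (k N : ℕ) : Fintype (Config k N) :=
  Fintype.subtype (Finset.piAntidiag Finset.univ N) (by intro m; simp)

instance instDecidableEqConfig (k N : ℕ) : DecidableEq (Config k N) :=
  inferInstanceAs (DecidableEq {m : Fin (k + 1) → ℕ // ∑ x, m x = N})

/-- Moving one untagged player from `z` to `y`, i.e. `μ ↦ μ + (e_y - e_z) / N`.  When nobody is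
in `z` the result would leave the simplex; the value there is irrelevant, since every
occurrence below is multiplied by the number of players in `z`. -/
def Config.move {k N : ℕ} (m : Config k N) (z y : Fin (k + 1)) : Config k N :=
  if h : 0 < m.1 z then
    ⟨fun w => m.1 w + (Pi.single y 1 : Fin (k + 1) → ℕ) w - (Pi.single z 1 : Fin (k + 1) → ℕ) w, by
      have h1 : ∀ w, (Pi.single z 1 : Fin (k + 1) → ℕ) w
          ≤ m.1 w + (Pi.single y 1 : Fin (k + 1) → ℕ) w := by
        intro w
        by_cases hw : w = z
        · subst hw
          simp only [Pi.single_eq_same]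
          omega
        · simp [hw]
      rw [Finset.sum_tsub_distrib _ (fun w _ => h1 w), Finset.sum_add_distrib, m.2]
      simp⟩
  else m

/-- The states `(x, μ)`: the position of the tagged player and the configuration of the
untagged ones. -/
abbrev State (k N : ℕ) : Type := Fin (k + 1) × Config k N

/-- `ℝ^{d-1}` with its Euclidean norm.  A vector `a` of rates out of `x` is read by
`α_y(x) = a_y` for `y < x` and `α_y(x) = a_{y-1}` for `y > x`: the coordinate `j` belongs to the
target `y = x.succAbove j`, and `j ↦ x.succAbove j` enumerates the `y ≠ x`. -/
abbrev Rates (k : ℕ) : Type := EuclideanSpace ℝ (Fin k)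

/-- The orthant `ℝ_+^{d-1}`. -/
def orthant (k : ℕ) : Set (Rates k) := {a | ∀ j, 0 ≤ a j}

/-- Feedback functions; only the values at times in `[0,T]` matter. -/
abbrev Control (k N : ℕ) : Type := ℝ → State k N → Rates k

/-- The data of the game with the standing assumptions. -/
structure Game (k N : ℕ) where
  /-- the horizon -/
  T : ℝ
  /-- the uncontrolled rates -/
  lam0 : State k N → Rates k
  lam1 : State k N → Rates k
  /-- the running cost -/
  cost : State k N → Rates k → ℝ
  /-- the terminal cost -/
  term : State k N → ℝ
  T_pos : 0 < T
  lam0_nonneg : ∀ s, lam0 s ∈ orthant k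
  lam1_nonneg : ∀ s, lam1 s ∈ orthant k
  cost_nonneg : ∀ s, ∀ a ∈ orthant k, 0 ≤ cost s a
  term_nonneg : ∀ s, 0 ≤ term s
  cost_continuous : ∀ s, ContinuousOn (cost s) (orthant k)
  /-- strong convexity of the running cost, uniformly in the state -/
  cost_convex : ∃ γ : ℝ, 0 < γ ∧ ∀ s, ∀ a ∈ orthant k, ∀ a' ∈ orthant k, ∀ τ ∈ Icc (0 : ℝ) 1,
    γ * τ * (1 - τ) * ‖a' - a‖ ^ 2
      ≤ τ * cost s a' + (1 - τ) * cost s a - cost s (τ • a' + (1 - τ) • a)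

/-! ### Norms -/

/-- `|φ|_2^2`, the sum over all states of the squared Euclidean norms. -/
noncomputable def sqNorm {k N : ℕ} {E : Type*} [NormedAddCommGroup E] (φ : State k N → E) : ℝ :=
  ∑ s, ‖φ s‖ ^ 2

/-- `|φ|_2`. -/
noncomputable def norm2 {k N : ℕ} {E : Type*} [NormedAddCommGroup E] (φ : State k N → E) : ℝ :=
  √(sqNorm φ)

/-- `max_{t ∈ [0,T]} |ψ(t)|_2`, for `ψ` continuous on `[0,T]`. -/
noncomputable def sNorm {k N : ℕ} {E : Type*} [NormedAddCommGroup E] (T : ℝ)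
    (ψ : ℝ → State k N → E) : ℝ :=
  ⨆ t : Icc (0 : ℝ) T, norm2 (ψ t)

/-- The sup norm over `[0,T]` of a real function, as an extended nonnegative real. -/
noncomputable def supNorm (T : ℝ) (f : ℝ → ℝ) : ℝ≥0∞ :=
  ⨆ t ∈ Icc (0 : ℝ) T, ENNReal.ofReal |f t|

namespace Game

variable {k N : ℕ} (G : Game k N)

/-! ### Dynamics -/

/-- Admissible controls: nonnegative rates that are Lipschitz on `[0,T] × State`.  As `State` is
finite, this is the Lipschitz property in time. -/
def admissible : Set (Control k N) :=
  {α | (∀ t ∈ Icc 0 G.T, ∀ s, α t s ∈ orthant k) ∧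
    ∃ K : NNReal, ∀ s, LipschitzOnWith K (fun t => α t s) (Icc 0 G.T)}

/-- Admissible controls with `sup_t |α(t)|_2 ≤ c`. -/
def admissibleBounded (c : ℝ) : Set (Control k N) :=
  {α | α ∈ G.admissible ∧ ∀ t ∈ Icc 0 G.T, norm2 (α t) ≤ c}

/-- The rate `λ⁰_y + λ¹_y a_y` from `s.1` to `y = s.1.succAbove j`, of a player in state `s.1` who
sees the configuration `s.2` and uses `a`. -/
def rate (s : State k N) (a : Rates k) (j : Fin k) : ℝ :=
  G.lam0 s j + G.lam1 s j * a j

/-- The generator of the moves of the tagged player. -/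
def genX (α : Control k N) (t : ℝ) (φ : State k N → ℝ) (s : State k N) : ℝ :=
  ∑ j, G.rate s (α t s) j * (φ (s.1.succAbove j, s.2) - φ s)

/-- The generator of the moves of the untagged players: one of the `n_z` players in `z` sees the
configuration `μ + (e_x - e_z) / N` and moves to `y = z.succAbove j`. -/
def genMu (β : Control k N) (t : ℝ) (φ : State k N → ℝ) (s : State k N) : ℝ :=
  ∑ z, ∑ j, (s.2.1 z : ℝ) * G.rate (z, s.2.move z s.1) (β t (z, s.2.move z s.1)) j *
    (φ (s.1, s.2.move z (z.succAbove j)) - φ s)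

/-- The generator of the controlled state process. -/
def gen (α β : Control k N) (t : ℝ) (φ : State k N → ℝ) (s : State k N) : ℝ :=
  G.genX α t φ s + G.genMu β t φ s

/-- `p u` is the law at time `u ∈ [t,T]` of the Markov chain with the generator `gen α β` that
starts from `s` at time `t`: a curve of probability vectors from the Dirac mass at `s` that
solves the Kolmogorov forward equation. -/
structure IsLaw (α β : Control k N) (t : ℝ) (s : State k N) (p : ℝ → State k N → ℝ) : Prop where
  init : p t = Pi.single s 1
  nonneg : ∀ u ∈ Icc t G.T, ∀ r, 0 ≤ p u r
  sum_one : ∀ u ∈ Icc t G.T, ∑ r, p u r = 1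
  forward : ∀ φ : State k N → ℝ, ∀ u ∈ Icc t G.T,
    HasDerivWithinAt (fun w => ∑ r, p w r * φ r) (∑ r, p u r * G.gen α β u φ r) (Icc t G.T) u

/-- The law of the controlled chain from `s` at time `t`; on `[t,T]` it is unique. -/
noncomputable def law (α β : Control k N) (t : ℝ) (s : State k N) : ℝ → State k N → ℝ :=
  Classical.epsilon (G.IsLaw α β t s)

/-! ### The control problem of the tagged player -/

/-- The cost `J(t,x,μ,α;β) = E[∫_t^T ℓ(Ξ_u, α(u,Ξ_u)) du + g(Ξ_T) | Ξ_t = (x,μ)]`. -/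
noncomputable def J (t : ℝ) (s : State k N) (α β : Control k N) : ℝ :=
  (∫ u in t..G.T, ∑ r, G.law α β t s u r * G.cost r (α u r)) +
    ∑ r, G.law α β t s G.T r * G.term r

/-- The value function `v^β`: the infimum of the cost over all admissible controls. -/
noncomputable def value (β : Control k N) (t : ℝ) (s : State k N) : ℝ :=
  ⨅ α : G.admissible, G.J t s α β

/-- The minimizer over the orthant of `ℓ(x,μ,a) + ∑_{y ≠ x} a_y λ¹_y(x,μ) p_y`. -/
noncomputable def argmin (s : State k N) (p : Rates k) : Rates k :=
  Classical.epsilon fun a => a ∈ orthant k ∧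
    IsMinOn (fun b : Rates k => G.cost s b + ∑ j, b j * G.lam1 s j * p j) (orthant k) a

/-- The vector `(φ(y,μ) - φ(x,μ))_{y ≠ x}`. -/
noncomputable def diff (φ : State k N → ℝ) (s : State k N) : Rates k :=
  WithLp.toLp 2 fun j => φ (s.1.succAbove j, s.2) - φ s

/-- The best response `α^*(β)`. -/
noncomputable def bestResponse (β : Control k N) : Control k N :=
  fun t s => G.argmin s (diff (G.value β t) s)

/-! ### The iterations -/

/-- The controls `β^{(n)}` of the exact iteration. -/
noncomputable def exactControl (ρ : ℝ) (β₀ : Control k N) : ℕ → Control k N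
  | 0 => β₀
  | n + 1 => fun t s => ρ • exactControl ρ β₀ n t s +
      (1 - ρ) • G.bestResponse (exactControl ρ β₀ n) t s

/-- The controls of the iteration whose `n`-th best response carries the error `ε n`. -/
noncomputable def corruptedControl (ρ : ℝ) (β₀ : Control k N) (ε : ℕ → Control k N) :
    ℕ → Control k N
  | 0 => β₀
  | n + 1 => fun t s => ρ • corruptedControl ρ β₀ ε n t s +
      (1 - ρ) • (G.bestResponse (corruptedControl ρ β₀ ε n) t s + ε (n + 1) t s)

/-- The exact values `v^{(n)}`, for `n ≥ 1`. -/
noncomputable def exactValue (ρ : ℝ) (β₀ : Control k N) (n : ℕ) : ℝ → State k N → ℝ :=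
  G.value (G.exactControl ρ β₀ (n - 1))

/-- The values of the corrupted iteration, for `n ≥ 1`. -/
noncomputable def corruptedValue (ρ : ℝ) (β₀ : Control k N) (ε : ℕ → Control k N) (n : ℕ) :
    ℝ → State k N → ℝ :=
  G.value (G.corruptedControl ρ β₀ ε (n - 1))

/-- The squared deviation `γ^{(n)}` of the controls. -/
noncomputable def controlDev (ρ : ℝ) (β₀ : Control k N) (ε : ℕ → Control k N) (n : ℕ)
    (t : ℝ) : ℝ :=
  sqNorm (fun s => G.corruptedControl ρ β₀ ε n t s - G.exactControl ρ β₀ n t s)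

/-- The squared deviation `q^{(n)}` of the values, for `n ≥ 1`. -/
noncomputable def valueDev (ρ : ℝ) (β₀ : Control k N) (ε : ℕ → Control k N) (n : ℕ)
    (t : ℝ) : ℝ :=
  sqNorm (fun s => G.corruptedValue ρ β₀ ε n t s - G.exactValue ρ β₀ n t s)

/-- The best response is `c`-Lipschitz in the value function:
`|α^*(β)(t) - α^*(β')(t)|_2 ≤ c |v^β(t) - v^β'(t)|_2` for admissible `β`, `β'`. -/
def ResponseBound (c : ℝ) : Prop :=
  ∀ β ∈ G.admissible, ∀ β' ∈ G.admissible, ∀ t ∈ Icc 0 G.T,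
    norm2 (fun s => G.bestResponse β t s - G.bestResponse β' t s)
      ≤ c * norm2 (fun s => G.value β t s - G.value β' t s)

/-- `|v^β(t) - v^β'(t)|_2^2 ≤ c ∫_t^T |β'(u) - β(u)|_2^2 du` for admissible `β`, `β'` bounded by
`ca`. -/
def ValueBound (ca c : ℝ) : Prop :=
  ∀ β ∈ G.admissibleBounded ca, ∀ β' ∈ G.admissibleBounded ca, ∀ t ∈ Icc 0 G.T,
    sqNorm (fun s => G.value β t s - G.value β' t s)
      ≤ c * ∫ u in t..G.T, sqNorm (fun s => β' u s - β u s)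

/-- An error function: continuous on `[0,T]`, with values in the orthant. -/
def IsError (e : Control k N) : Prop :=
  (∀ t ∈ Icc 0 G.T, ∀ s, e t s ∈ orthant k) ∧ ∀ s, ContinuousOn (fun t => e t s) (Icc 0 G.T)

end Game

/-- The constant `2 (1 - ρ) (c₀² ∨ 1)`. -/
noncomputable def cHat (c₀ ρ : ℝ) : ℝ := 2 * (1 - ρ) * max (c₀ ^ 2) 1

/-- The sum `Γ^{(m)}(t)`, where `e n` stands for the norm of the `n`-th error. -/
noncomputable def gammaBound (T c₀ cs ρ : ℝ) (e : ℕ → ℝ) (m : ℕ) (t : ℝ) : ℝ :=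
  cHat c₀ ρ * ∑ i ∈ Finset.Icc 1 m, e (m + 1 - i) ^ 2 *
    ∑ j ∈ Finset.Icc 1 i, ((i - 1).choose (j - 1) : ℝ) * ρ ^ (i - j) *
      ((cs * cHat c₀ ρ) ^ (j - 1) * (T - t) ^ (j - 1) / ((j - 1).factorial : ℝ))

/-- The sum `Q^{(n)}(t)`, where `e n` stands for the norm of the `n`-th error. -/
noncomputable def valueBound (T c₀ cs ρ : ℝ) (e : ℕ → ℝ) (n : ℕ) (t : ℝ) : ℝ :=
  ∑ i ∈ Finset.Icc 1 (n - 1), e (n - i) ^ 2 *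
    ∑ j ∈ Finset.Icc 1 i, ((i - 1).choose (j - 1) : ℝ) * ρ ^ (i - j) *
      ((cs * cHat c₀ ρ) ^ j * (T - t) ^ j / (j.factorial : ℝ))

end PicardGame

/-! For a fixed continuous feedback `β` of the untagged players, the tagged player faces a
finite-state control problem whose value solves a backward system of ODEs, the
Hamilton-Jacobi-Bellman equation. Truncation makes its field globally Lipschitz, a comparison
argument shows that the truncation is inactive (`exists_isHJB`), and Dynkin's formula identifies the
solution with the infimum of the cost (`IsHJB.value_eq`). The infimum over Lipschitz controls is
attained even if `β` is only continuous, since the solution, and with it the minimizing feedback, is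
Lipschitz in time. This matters because the errors are only continuous, so the corrupted controls
may leave the admissible class; the estimates are therefore proved for all continuous feedbacks
(`IsFeedback`).

Two stability estimates carry the theorem. Strong convexity makes the minimizer Lipschitz in the
adjoint variable, hence the best response Lipschitz in the value (`exists_response_lipschitz`).
Evaluating the solution for `β` along the chain driven by `β'` and its optimal feedback bounds the
difference of the values by the time integral of |β' - β| (`value_le_add`). The constant uses only
the bound 0 ≤ v ≤ `valueCap 0`, which holds for every `β`, so it does not depend on `ca`.

Together they give γ^(n+1) ≤ ρ γ^(n) + ĉ (q^(n+1) + ‖ε^(n+1)‖²) and q^(n+1)(t) ≤ c* ∫_t^T γ^(n). The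
sums `gammaBound` and `valueBound` satisfy this recursion with equality: with I f(t) = ∫_t^T f, each
step applies the operator ρ + ĉ c* I to the earlier contributions, and the binomial theorem with I^j
1 = (T-t)^j / j! yields the double sum. For the uniform bound, a suitable multiple of exp(K (T-t))
with K = c* ĉ / (1-ρ) is reproduced by the same recursion when all squared errors are replaced by
one common bound (`controlDev_le_exp`). -/

namespace PicardGame

/-! ### Ordinary differential equations -/

/-- A vector field that is globally bounded, globally Lipschitz in space and continuous in time has
solutions on the whole time interval. -/
theorem exists_solution_of_lipschitz_bounded {E : Type*} [NormedAddCommGroup E] [NormedSpace ℝ E]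
    [CompleteSpace E] {f : ℝ → E → E} {a b t₀ : ℝ} (ht₀ : t₀ ∈ Icc a b) (x₀ : E) {K L : NNReal}
    (hlip : ∀ t ∈ Icc a b, LipschitzWith K (f t))
    (hcont : ∀ x, ContinuousOn (fun t => f t x) (Icc a b))
    (hL : ∀ t ∈ Icc a b, ∀ x, ‖f t x‖ ≤ L) :
    ∃ y : ℝ → E, y t₀ = x₀ ∧ ∀ t ∈ Icc a b, HasDerivWithinAt y (f t (y t)) (Icc a b) t := by
  have hab : a ≤ b := ht₀.1.trans ht₀.2
  have hpl : IsPicardLindelof f (⟨t₀, ht₀⟩ : Icc a b) x₀ (L * (b - a).toNNReal) 0 L K :=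
    { lipschitzOnWith := fun t ht => (hlip t ht).lipschitzOnWith
      continuousOn := fun x _ => hcont x
      norm_le := fun t ht x _ => hL t ht x
      mul_max_le := by
        simp only [NNReal.coe_mul, Real.coe_toNNReal _ (sub_nonneg.2 hab), NNReal.coe_zero,
          sub_zero]
        gcongr
        exact max_le (by linarith [ht₀.1]) (by linarith [ht₀.2]) }
  exact hpl.exists_eq_forall_mem_Icc_hasDerivWithinAt₀

/-- A function that starts nonnegative and does not decrease while it is negative stays
nonnegative. -/
theorem nonneg_of_deriv_nonneg_of_neg {u u' : ℝ → ℝ} {a b : ℝ}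
    (hu : ∀ t ∈ Icc a b, HasDerivWithinAt u (u' t) (Icc a b) t) (ha : 0 ≤ u a)
    (h : ∀ t ∈ Icc a b, u t < 0 → 0 ≤ u' t) : ∀ t ∈ Icc a b, 0 ≤ u t := by
  intro t ht
  by_contra! hneg
  have hc : ContinuousOn u (Icc a b) := fun t ht => (hu t ht).continuousWithinAt
  have hc' : ContinuousOn u (Icc a t) := hc.mono (Icc_subset_Icc_right ht.2)
  have hS : IsCompact (Icc a t ∩ u ⁻¹' Ici 0) :=
    isCompact_Icc.of_isClosed_subset (hc'.preimage_isClosed_of_isClosed isClosed_Icc isClosed_Ici)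
      inter_subset_left
  -- `r` is the last time before `t` at which `u` is nonnegative; after it `u` is negative, hence
  -- nondecreasing.
  obtain ⟨r, ⟨hr, hr0⟩, hmax⟩ := hS.exists_isGreatest ⟨a, left_mem_Icc.2 ht.1, ha⟩
  have hsub : Icc r t ⊆ Icc a b := Icc_subset_Icc hr.1 ht.2
  have hd : ∀ w ∈ interior (Icc r t), HasDerivAt u (u' w) w := by
    intro w hw
    rw [interior_Icc] at hw
    exact (hu w (hsub (Ioo_subset_Icc_self hw))).hasDerivAt
      (Icc_mem_nhds (hr.1.trans_lt hw.1) (hw.2.trans_le ht.2))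
  have hmono : MonotoneOn u (Icc r t) := by
    refine monotoneOn_of_deriv_nonneg (convex_Icc r t) (hc.mono hsub)
      (fun w hw => (hd w hw).differentiableAt.differentiableWithinAt) fun w hw => ?_
    rw [(hd w hw).deriv]
    rw [interior_Icc] at hw
    refine h w (hsub (Ioo_subset_Icc_self hw)) ?_
    by_contra! h0
    exact absurd (hmax ⟨⟨hr.1.trans hw.1.le, hw.2.le⟩, h0⟩) (not_le.2 hw.1)
  have := hmono (left_mem_Icc.2 hr.2) (right_mem_Icc.2 hr.2) hr.2
  exact absurd (le_trans hr0 this) (not_le.2 hneg)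

/-- The version of `nonneg_of_deriv_nonneg_of_neg` for a terminal condition. -/
theorem nonneg_of_deriv_nonpos_of_neg {u u' : ℝ → ℝ} {a b : ℝ}
    (hu : ∀ t ∈ Icc a b, HasDerivWithinAt u (u' t) (Icc a b) t) (hb : 0 ≤ u b)
    (h : ∀ t ∈ Icc a b, u t < 0 → u' t ≤ 0) : ∀ t ∈ Icc a b, 0 ≤ u t := by
  have hmem : ∀ t ∈ Icc a b, a + b - t ∈ Icc a b := fun t ht =>
    ⟨by linarith [ht.2], by linarith [ht.1]⟩
  intro t ht
  have key := nonneg_of_deriv_nonneg_of_neg (u := fun t => u (a + b - t))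
    (u' := fun t => -u' (a + b - t)) (a := a) (b := b)
    (fun t ht => by
      have h1 : HasDerivWithinAt (fun t : ℝ => a + b - t) (-1) (Icc a b) t := by
        simpa using (hasDerivWithinAt_id t (Icc a b)).const_sub (a + b)
      simpa [Function.comp_def] using (hu _ (hmem t ht)).comp t h1 hmem)
    (by simpa using hb)
    (fun t ht h0 => by simpa using h _ (hmem t ht) h0) (a + b - t) (hmem t ht)
  simpa using key

/-- The Cauchy-Schwarz inequality for the integral of a continuous function. -/
theorem sq_integral_le_mul_integral_sq {f : ℝ → ℝ} {a b : ℝ} (hab : a ≤ b)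
    (hf : ContinuousOn f (Icc a b)) :
    (∫ u in a..b, f u) ^ 2 ≤ (b - a) * ∫ u in a..b, f u ^ 2 := by
  rcases hab.eq_or_lt with rfl | hlt
  · simp
  have hpos : 0 < b - a := sub_pos.2 hlt
  have hi : IntervalIntegrable f MeasureTheory.volume a b := hf.intervalIntegrable_of_Icc hab
  have hi2 : IntervalIntegrable (fun u => f u ^ 2) MeasureTheory.volume a b :=
    (hf.pow 2).intervalIntegrable_of_Icc hab
  set I := ∫ u in a..b, f u
  -- The mean of `f`; the inequality is the nonnegativity of its variance.
  set c := I / (b - a)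
  have h0 : 0 ≤ ∫ u in a..b, (f u - c) ^ 2 :=
    intervalIntegral.integral_nonneg hab fun u _ => sq_nonneg _
  have h1 : ∫ u in a..b, (f u - c) ^ 2 = (∫ u in a..b, f u ^ 2) - 2 * c * I + c ^ 2 * (b - a) := by
    have : ∀ u, (f u - c) ^ 2 = f u ^ 2 - 2 * c * f u + c ^ 2 := fun u => by ring
    simp_rw [this]
    rw [intervalIntegral.integral_add (hi2.sub (hi.const_mul _)) (by simp),
      intervalIntegral.integral_sub hi2 (hi.const_mul _), intervalIntegral.integral_const_mul,
      intervalIntegral.integral_const, smul_eq_mul]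
    ring
  rw [h1] at h0
  have hc : c * (b - a) = I := div_mul_cancel₀ I hpos.ne'
  have := mul_nonneg hpos.le h0
  nlinarith [this]

/-! ### Norms of functions on the state space -/

section Norms

variable {k N : ℕ} {E : Type*} [NormedAddCommGroup E]

theorem sqNorm_nonneg (φ : State k N → E) : 0 ≤ sqNorm φ :=
  Finset.sum_nonneg fun _ _ => sq_nonneg _

theorem norm2_nonneg (φ : State k N → E) : 0 ≤ norm2 φ := Real.sqrt_nonneg _

theorem norm2_sq (φ : State k N → E) : norm2 φ ^ 2 = sqNorm φ := Real.sq_sqrt (sqNorm_nonneg φ)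

theorem norm_le_norm2 (φ : State k N → E) (s : State k N) : ‖φ s‖ ≤ norm2 φ :=
  Real.le_sqrt_of_sq_le
    (Finset.single_le_sum (f := fun s => ‖φ s‖ ^ 2) (fun _ _ => sq_nonneg _) (Finset.mem_univ s))

theorem sqNorm_le_card_mul {φ : State k N → E} {c : ℝ} (h : ∀ s, ‖φ s‖ ≤ c) :
    sqNorm φ ≤ Fintype.card (State k N) * c ^ 2 := by
  calc sqNorm φ ≤ ∑ _s : State k N, c ^ 2 :=
        Finset.sum_le_sum fun s _ => pow_le_pow_left₀ (norm_nonneg _) (h s) 2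
    _ = _ := by simp

theorem continuousOn_sqNorm {ψ : ℝ → State k N → E} {S : Set ℝ}
    (h : ∀ s, ContinuousOn (fun t => ψ t s) S) : ContinuousOn (fun t => sqNorm (ψ t)) S :=
  continuousOn_finsetSum _ fun s _ => ((h s).norm).pow 2

theorem continuousOn_norm2 {ψ : ℝ → State k N → E} {S : Set ℝ}
    (h : ∀ s, ContinuousOn (fun t => ψ t s) S) : ContinuousOn (fun t => norm2 (ψ t)) S :=
  (continuousOn_sqNorm h).sqrt

theorem norm2_le_sNorm {ψ : ℝ → State k N → E} {T : ℝ}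
    (h : ∀ s, ContinuousOn (fun t => ψ t s) (Icc 0 T)) {t : ℝ} (ht : t ∈ Icc 0 T) :
    norm2 (ψ t) ≤ sNorm T ψ := by
  obtain ⟨C, hC⟩ := isCompact_Icc.exists_bound_of_continuousOn (continuousOn_norm2 h)
  refine le_ciSup (f := fun t : Icc (0 : ℝ) T => norm2 (ψ t)) ⟨C, ?_⟩ ⟨t, ht⟩
  rintro _ ⟨u, rfl⟩
  exact (le_abs_self _).trans (hC u u.2)

end Norms

/-! ### The Hamiltonian -/

theorem isClosed_orthant (k : ℕ) : IsClosed (orthant k) := by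
  have : orthant k = ⋂ j, {a : Rates k | 0 ≤ a j} := by ext; simp [orthant]
  rw [this]
  exact isClosed_iInter fun j => isClosed_le continuous_const (by fun_prop)

theorem zero_mem_orthant (k : ℕ) : (0 : Rates k) ∈ orthant k := fun j => by simp

theorem combo_mem_orthant {k : ℕ} {a b : Rates k} (ha : a ∈ orthant k) (hb : b ∈ orthant k)
    {σ τ : ℝ} (hσ : 0 ≤ σ) (hτ : 0 ≤ τ) : σ • a + τ • b ∈ orthant k := fun j => by
  simpa using add_nonneg (mul_nonneg hσ (ha j)) (mul_nonneg hτ (hb j))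

theorem abs_coord_le_norm {k : ℕ} (a : Rates k) (j : Fin k) : |a j| ≤ ‖a‖ := by
  simpa using PiLp.norm_apply_le a j

namespace Game

variable {k N : ℕ} (G : Game k N)

/-- The sum of all the controlled rates bounds each of them. -/
noncomputable def lamSum : ℝ := ∑ s, ∑ j, G.lam1 s j

theorem lamSum_nonneg : 0 ≤ G.lamSum :=
  Finset.sum_nonneg fun s _ => Finset.sum_nonneg fun j _ => G.lam1_nonneg s j

theorem sum_lam1_le (s : State k N) : ∑ j, G.lam1 s j ≤ G.lamSum :=
  Finset.single_le_sum (f := fun s => ∑ j, G.lam1 s j)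
    (fun s _ => Finset.sum_nonneg fun j _ => G.lam1_nonneg s j) (Finset.mem_univ s)

/-- The linear part `∑ a_y λ¹_y p_y` of the minimized expression. -/
def pairing (s : State k N) (a p : Rates k) : ℝ := ∑ j, a j * G.lam1 s j * p j

theorem pairing_abs_le (s : State k N) (a p : Rates k) :
    |G.pairing s a p| ≤ G.lamSum * ‖a‖ * ‖p‖ := by
  calc |G.pairing s a p| ≤ ∑ j, |a j * G.lam1 s j * p j| := Finset.abs_sum_le_sum_abs _ _
    _ ≤ ∑ j, G.lam1 s j * (‖a‖ * ‖p‖) := by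
        refine Finset.sum_le_sum fun j _ => ?_
        have h0 := G.lam1_nonneg s j
        rw [abs_mul, abs_mul, abs_of_nonneg h0]
        have := mul_le_mul (abs_coord_le_norm a j) (abs_coord_le_norm p j) (abs_nonneg _)
          (norm_nonneg _)
        nlinarith [mul_le_mul_of_nonneg_left this h0]
    _ = (∑ j, G.lam1 s j) * (‖a‖ * ‖p‖) := by rw [Finset.sum_mul]
    _ ≤ G.lamSum * (‖a‖ * ‖p‖) := by gcongr; exact G.sum_lam1_le s
    _ = _ := by ring

theorem pairing_sub_right (s : State k N) (a p q : Rates k) :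
    G.pairing s a (p - q) = G.pairing s a p - G.pairing s a q := by
  simp [pairing, mul_sub]

theorem pairing_sub_left (s : State k N) (a b p : Rates k) :
    G.pairing s (a - b) p = G.pairing s a p - G.pairing s b p := by
  simp [pairing, sub_mul]

theorem pairing_combo (s : State k N) (a b p : Rates k) (σ τ : ℝ) :
    G.pairing s (σ • a + τ • b) p = σ * G.pairing s a p + τ * G.pairing s b p := by
  simp only [pairing, PiLp.add_apply, PiLp.smul_apply, smul_eq_mul, Finset.mul_sum,
    ← Finset.sum_add_distrib]
  exact Finset.sum_congr rfl fun j _ => by ring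

theorem continuous_pairing (s : State k N) :
    Continuous fun q : Rates k × Rates k => G.pairing s q.1 q.2 := by
  unfold pairing
  fun_prop

/-- The minimum is attained. -/
theorem exists_argmin (s : State k N) (p : Rates k) :
    ∃ a, a ∈ orthant k ∧ IsMinOn (fun b => G.cost s b + G.pairing s b p) (orthant k) a := by
  obtain ⟨γ, hγ, hconv⟩ := G.cost_convex
  have hcont : ContinuousOn (fun b => G.cost s b + G.pairing s b p) (orthant k) :=
    (G.cost_continuous s).add
      ((G.continuous_pairing s).comp (by fun_prop : Continuous fun b => (b, p))).continuousOn
  refine hcont.exists_isMinOn' (isClosed_orthant k) (zero_mem_orthant k) ?_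
  set A := G.lamSum * ‖p‖
  have hA : 0 ≤ A := mul_nonneg G.lamSum_nonneg (norm_nonneg _)
  have hc0 := G.cost_nonneg s 0 (zero_mem_orthant k)
  -- Strong convexity at the midpoint of 0 and `b`, with `cost ≥ 0` there, gives `cost b ≥ γ/2 ‖b‖²
  -- - cost 0`. Beyond this threshold the quadratic term beats the linear part, and the objective
  -- exceeds its value at 0.
  have hlarge : ∀ᶠ b : Rates k in Filter.cocompact _, (A + 2 * G.cost s 0) * 2 / γ + 1 ≤ ‖b‖ :=
    tendsto_norm_cocompact_atTop.eventually_ge_atTop _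
  rw [Filter.eventually_inf_principal]
  filter_upwards [hlarge] with b hb hbo
  have h1 := hconv s 0 (zero_mem_orthant k) b hbo (1 / 2) ⟨by norm_num, by norm_num⟩
  have h2 := G.cost_nonneg s _ (combo_mem_orthant hbo (zero_mem_orthant k)
    (by norm_num : (0 : ℝ) ≤ 1 / 2) (by norm_num : (0 : ℝ) ≤ 1 - 1 / 2))
  have h3 := neg_le_of_abs_le (G.pairing_abs_le s b p)
  have h4 : G.pairing s 0 p = 0 := by simp [pairing]
  have h5 : A + 2 * G.cost s 0 ≤ γ / 2 * (‖b‖ - 1) := by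
    have : (A + 2 * G.cost s 0) * 2 / γ ≤ ‖b‖ - 1 := by linarith
    rw [div_le_iff₀ hγ] at this
    linarith
  have hb1 : 1 ≤ ‖b‖ := by
    have : 0 ≤ (A + 2 * G.cost s 0) * 2 / γ := by positivity
    linarith
  rw [sub_zero] at h1
  simp only [h4, add_zero]
  have h6 : G.lamSum * ‖b‖ * ‖p‖ = A * ‖b‖ := by ring
  nlinarith [mul_le_mul_of_nonneg_right h5 (norm_nonneg b)]

theorem argmin_spec (s : State k N) (p : Rates k) : G.argmin s p ∈ orthant k ∧
    ∀ b ∈ orthant k, G.cost s (G.argmin s p) + G.pairing s (G.argmin s p) p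
      ≤ G.cost s b + G.pairing s b p :=
  Classical.epsilon_spec (p := fun a => a ∈ orthant k ∧
    IsMinOn (fun b : Rates k => G.cost s b + ∑ j, b j * G.lam1 s j * p j) (orthant k) a)
    (G.exists_argmin s p)

theorem argmin_mem (s : State k N) (p : Rates k) : G.argmin s p ∈ orthant k :=
  (G.argmin_spec s p).1

/-- The minimizer is Lipschitz in the adjoint variable. -/
theorem exists_argmin_lipschitz : ∃ c : ℝ, 0 ≤ c ∧ ∀ (s : State k N) (p q : Rates k),
    ‖G.argmin s p - G.argmin s q‖ ≤ c * ‖p - q‖ := by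
  obtain ⟨γ, hγ, hconv⟩ := G.cost_convex
  refine ⟨G.lamSum / γ, div_nonneg G.lamSum_nonneg hγ.le, fun s p q => ?_⟩
  -- Quadratic growth away from the minimizer, from comparing it with its midpoint to `b`. Adding
  -- the instances for `p` and `q` cancels the costs and leaves γ‖a - b‖² ≤ -pairing (a - b) (p -
  -- q).
  have key : ∀ p : Rates k, ∀ b ∈ orthant k, G.cost s (G.argmin s p)
      + G.pairing s (G.argmin s p) p + γ / 2 * ‖b - G.argmin s p‖ ^ 2
        ≤ G.cost s b + G.pairing s b p := by
    intro p b hb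
    obtain ⟨ha, hmin⟩ := G.argmin_spec s p
    have h1 := hconv s _ ha b hb (1 / 2) ⟨by norm_num, by norm_num⟩
    have h2 := hmin _ (combo_mem_orthant hb ha (by norm_num : (0 : ℝ) ≤ 1 / 2)
      (by norm_num : (0 : ℝ) ≤ 1 - 1 / 2))
    rw [pairing_combo] at h2
    linarith
  have h1 := key p _ (G.argmin_mem s q)
  have h2 := key q _ (G.argmin_mem s p)
  rw [norm_sub_rev] at h1
  set a := G.argmin s p
  set b := G.argmin s q
  have h3 := neg_le_of_abs_le (G.pairing_abs_le s (a - b) (p - q))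
  rw [pairing_sub_left, pairing_sub_right, pairing_sub_right] at h3
  rw [div_mul_eq_mul_div, le_div_iff₀ hγ]
  rcases (norm_nonneg (a - b)).eq_or_lt with h0 | h0
  · rw [← h0, zero_mul]
    exact mul_nonneg G.lamSum_nonneg (norm_nonneg _)
  · refine le_of_mul_le_mul_right ?_ h0
    nlinarith

/-- The minimal value, a function of the adjoint variable. -/
noncomputable def minCost (s : State k N) (p : Rates k) : ℝ :=
  G.cost s (G.argmin s p) + G.pairing s (G.argmin s p) p

theorem minCost_le (s : State k N) (p : Rates k) {a : Rates k} (ha : a ∈ orthant k) :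
    G.minCost s p ≤ G.cost s a + G.pairing s a p :=
  (G.argmin_spec s p).2 a ha

theorem minCost_nonneg (s : State k N) {p : Rates k} (hp : ∀ j, 0 ≤ p j) : 0 ≤ G.minCost s p :=
  add_nonneg (G.cost_nonneg s _ (G.argmin_mem s p)) (Finset.sum_nonneg fun j _ =>
    mul_nonneg (mul_nonneg (G.argmin_mem s p j) (G.lam1_nonneg s j)) (hp j))

theorem minCost_le_cost_zero (s : State k N) (p : Rates k) : G.minCost s p ≤ G.cost s 0 := by
  simpa [pairing] using G.minCost_le s p (zero_mem_orthant k)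

/-- The minimal cost is Lipschitz on bounded sets. -/
theorem exists_minCost_lipschitz (R : ℝ) (hR : 0 ≤ R) : ∃ c : ℝ, 0 ≤ c ∧
    ∀ (s : State k N) (p q : Rates k), ‖p‖ ≤ R → ‖q‖ ≤ R →
      |G.minCost s p - G.minCost s q| ≤ c * ‖p - q‖ := by
  obtain ⟨c, hc, hlip⟩ := G.exists_argmin_lipschitz
  set A := ∑ s, ‖G.argmin s 0‖
  have hA : ∀ s, ‖G.argmin s 0‖ ≤ A := fun s =>
    Finset.single_le_sum (f := fun s => ‖G.argmin s 0‖) (fun _ _ => norm_nonneg _)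
      (Finset.mem_univ s)
  have hA0 : 0 ≤ A := Finset.sum_nonneg fun _ _ => norm_nonneg _
  refine ⟨G.lamSum * (A + c * R), mul_nonneg G.lamSum_nonneg (by positivity), ?_⟩
  -- The minimizer for `q` is a competitor for `p`; its norm is at most `A + c * R` by the Lipschitz
  -- bound from 0.
  have key : ∀ (s : State k N) (p q : Rates k), ‖q‖ ≤ R →
      G.minCost s p - G.minCost s q ≤ G.lamSum * (A + c * R) * ‖p - q‖ := by
    intro s p q hq
    have h1 := G.minCost_le s p (G.argmin_mem s q)
    have h2 := (le_abs_self _).trans (G.pairing_abs_le s (G.argmin s q) (p - q))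
    rw [pairing_sub_right] at h2
    have h3 : ‖G.argmin s q‖ ≤ A + c * R := by
      have := hlip s q 0
      rw [sub_zero] at this
      calc ‖G.argmin s q‖ = ‖G.argmin s 0 + (G.argmin s q - G.argmin s 0)‖ := by congr 1; abel
        _ ≤ ‖G.argmin s 0‖ + ‖G.argmin s q - G.argmin s 0‖ := norm_add_le _ _
        _ ≤ A + c * R := add_le_add (hA s) (this.trans (by gcongr))
    have h4 : G.lamSum * ‖G.argmin s q‖ * ‖p - q‖ ≤ G.lamSum * (A + c * R) * ‖p - q‖ := by
      have := G.lamSum_nonneg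
      gcongr
    have h5 : G.minCost s q = G.cost s (G.argmin s q) + G.pairing s (G.argmin s q) q := rfl
    linarith
  intro s p q hp hq
  rw [abs_le]
  constructor
  · have := key s q p hp
    rw [norm_sub_rev] at this
    linarith
  · exact key s p q hq

theorem continuous_minCost (s : State k N) : Continuous (G.minCost s) := by
  rw [continuous_iff_continuousAt]
  intro p
  obtain ⟨c, hc, h⟩ := G.exists_minCost_lipschitz (‖p‖ + 1) (by positivity)
  have hL : LipschitzOnWith c.toNNReal (G.minCost s) (Metric.closedBall 0 (‖p‖ + 1)) := by
    refine LipschitzOnWith.of_dist_le_mul fun x hx y hy => ?_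
    rw [Real.dist_eq, dist_eq_norm, Real.coe_toNNReal _ hc]
    exact h s x y (by simpa using hx) (by simpa using hy)
  refine hL.continuousOn.continuousAt ?_
  refine Filter.mem_of_superset (Metric.ball_mem_nhds p one_pos) fun x hx => ?_
  rw [mem_closedBall_zero_iff]
  have h1 : ‖x - p‖ < 1 := by simpa [dist_eq_norm] using hx
  have h2 := norm_add_le (x - p) p
  rw [sub_add_cancel] at h2
  linarith

end Game

namespace Game

variable {k N : ℕ} (G : Game k N)

/-! ### The generator -/

/-- Feedback functions with nonnegative rates that are continuous in time. -/
def IsFeedback (β : Control k N) : Prop :=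
  (∀ t ∈ Icc 0 G.T, ∀ s, β t s ∈ orthant k) ∧ ∀ s, ContinuousOn (fun t => β t s) (Icc 0 G.T)

variable {G}

theorem isFeedback_zero : G.IsFeedback 0 :=
  ⟨fun _ _ _ => zero_mem_orthant k, fun _ => continuousOn_const⟩

theorem isFeedback_of_admissible {α : Control k N} (h : α ∈ G.admissible) : G.IsFeedback α :=
  ⟨h.1, fun s => h.2.choose_spec s |>.continuousOn⟩

theorem IsFeedback.continuousOn_coord {β : Control k N} (h : G.IsFeedback β) (s : State k N)
    (j : Fin k) : ContinuousOn (fun t => β t s j) (Icc 0 G.T) :=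
  (by fun_prop : Continuous fun a : Rates k => a j).comp_continuousOn (h.2 s)

variable (G)

theorem rate_nonneg (s : State k N) {a : Rates k} (ha : a ∈ orthant k) (j : Fin k) :
    0 ≤ G.rate s a j :=
  add_nonneg (G.lam0_nonneg s j) (mul_nonneg (G.lam1_nonneg s j) (ha j))

/-- The generator at a fixed time as a linear map. -/
noncomputable def genLin (α β : Control k N) (t : ℝ) :
    (State k N → ℝ) →ₗ[ℝ] (State k N → ℝ) where
  toFun φ := G.gen α β t φ
  map_add' φ ψ := by
    ext s
    simp only [gen, genX, genMu, Pi.add_apply]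
    have : ∀ a b c d e : ℝ, e * (a + b - (c + d)) = e * (a - c) + e * (b - d) := by
      intros; ring
    simp only [this, Finset.sum_add_distrib]
    ring
  map_smul' c φ := by
    ext s
    simp only [gen, genX, genMu, Pi.smul_apply, smul_eq_mul, RingHom.id_apply, mul_add,
      Finset.mul_sum]
    congr 1
    · exact Finset.sum_congr rfl fun _ _ => by ring
    · exact Finset.sum_congr rfl fun _ _ => Finset.sum_congr rfl fun _ _ => by ring

/-- Matrix form of the generator: its value on the indicator of `r`, at `s`, is the entry of the
rate matrix for the jump from `s` to `r`. -/
theorem gen_eq_sum (α β : Control k N) (t : ℝ) (φ : State k N → ℝ) (s : State k N) :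
    G.gen α β t φ s = ∑ r, φ r * G.gen α β t (Pi.single r 1) s := by
  have h := congrFun (LinearMap.pi_apply_eq_sum_univ (G.genLin α β t) φ) s
  rw [Finset.sum_apply] at h
  refine h.trans (Finset.sum_congr rfl fun r _ => ?_)
  have h1 : (fun j => if r = j then (1 : ℝ) else 0) = Pi.single r 1 := by
    ext j; simp [Pi.single_apply, eq_comm]
  simp only [Pi.smul_apply, smul_eq_mul, h1]
  rfl

theorem gen_sub (α β : Control k N) (t : ℝ) (φ ψ : State k N → ℝ) (s : State k N) :
    G.gen α β t (φ - ψ) s = G.gen α β t φ s - G.gen α β t ψ s :=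
  congrFun ((G.genLin α β t).map_sub φ ψ) s

theorem gen_neg (α β : Control k N) (t : ℝ) (φ : State k N → ℝ) (s : State k N) :
    G.gen α β t (-φ) s = -G.gen α β t φ s :=
  congrFun ((G.genLin α β t).map_neg φ) s

theorem sum_gen_single (α β : Control k N) (t : ℝ) (s : State k N) :
    ∑ r, G.gen α β t (Pi.single r 1) s = 0 := by
  have h := G.gen_eq_sum α β t (fun _ => 1) s
  simp only [one_mul] at h
  rw [← h]
  simp [gen, genX, genMu]

variable {G}

/-- The generator is nonnegative at a minimum. -/
theorem gen_nonneg_of_min {α β : Control k N} (hα : G.IsFeedback α) (hβ : G.IsFeedback β) {t : ℝ}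
    (ht : t ∈ Icc 0 G.T) {φ : State k N → ℝ} {s : State k N} (h : ∀ r, φ s ≤ φ r) :
    0 ≤ G.gen α β t φ s :=
  add_nonneg
    (Finset.sum_nonneg fun j _ =>
      mul_nonneg (G.rate_nonneg s (hα.1 t ht s) j) (sub_nonneg.2 (h _)))
    (Finset.sum_nonneg fun _ _ => Finset.sum_nonneg fun j _ =>
      mul_nonneg (mul_nonneg (Nat.cast_nonneg _) (G.rate_nonneg _ (hβ.1 t ht _) j))
        (sub_nonneg.2 (h _)))

/-- The generator is nonpositive at a maximum. -/
theorem gen_nonpos_of_max {α β : Control k N} (hα : G.IsFeedback α) (hβ : G.IsFeedback β) {t : ℝ}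
    (ht : t ∈ Icc 0 G.T) {φ : State k N → ℝ} {s : State k N} (h : ∀ r, φ r ≤ φ s) :
    G.gen α β t φ s ≤ 0 := by
  have := gen_nonneg_of_min hα hβ ht (φ := -φ) (s := s) fun r => neg_le_neg (h r)
  rw [gen_neg] at this
  linarith

theorem continuousOn_gen {α β : Control k N} (hα : G.IsFeedback α) (hβ : G.IsFeedback β)
    {φ : ℝ → State k N → ℝ} {S : Set ℝ} (hS : S ⊆ Icc 0 G.T)
    (hφ : ∀ s, ContinuousOn (fun t => φ t s) S) (s : State k N) :
    ContinuousOn (fun t => G.gen α β t (φ t) s) S := by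
  have h1 := fun s j => (hα.continuousOn_coord s j).mono hS
  have h2 := fun s j => (hβ.continuousOn_coord s j).mono hS
  refine ContinuousOn.add ?_ ?_
  · exact continuousOn_finsetSum _ fun j _ =>
      (continuousOn_const.add (continuousOn_const.mul (h1 s j))).mul ((hφ _).sub (hφ s))
  · exact continuousOn_finsetSum _ fun z _ => continuousOn_finsetSum _ fun j _ =>
      (continuousOn_const.mul (continuousOn_const.add (continuousOn_const.mul (h2 _ j)))).mul
        ((hφ _).sub (hφ s))

theorem continuousOn_gen_const {α β : Control k N} (hα : G.IsFeedback α) (hβ : G.IsFeedback β)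
    (φ : State k N → ℝ) (s : State k N) :
    ContinuousOn (fun t => G.gen α β t φ s) (Icc 0 G.T) :=
  continuousOn_gen hα hβ (φ := fun _ => φ) subset_rfl (fun _ => continuousOn_const) s

/-- The generator is bounded, uniformly in time. -/
theorem exists_gen_bound {α β : Control k N} (hα : G.IsFeedback α) (hβ : G.IsFeedback β) :
    ∃ C : ℝ, 0 ≤ C ∧ ∀ t ∈ Icc 0 G.T, ∀ (φ : State k N → ℝ) (s : State k N),
      |G.gen α β t φ s| ≤ C * ‖φ‖ := by
  have hc : ContinuousOn (fun t => ∑ s, ∑ r, |G.gen α β t (Pi.single r 1) s|) (Icc 0 G.T) :=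
    continuousOn_finsetSum _ fun s _ => continuousOn_finsetSum _ fun r _ =>
      (continuousOn_gen_const hα hβ (Pi.single r 1) s).abs
  obtain ⟨C, hC⟩ := isCompact_Icc.exists_bound_of_continuousOn hc
  refine ⟨C, (norm_nonneg _).trans (hC 0 (left_mem_Icc.2 G.T_pos.le)), fun t ht φ s => ?_⟩
  rw [gen_eq_sum]
  calc |∑ r, φ r * G.gen α β t (Pi.single r 1) s|
      ≤ ∑ r, |φ r * G.gen α β t (Pi.single r 1) s| := Finset.abs_sum_le_sum_abs _ _
    _ ≤ ∑ r, ‖φ‖ * |G.gen α β t (Pi.single r 1) s| := by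
        refine Finset.sum_le_sum fun r _ => ?_
        rw [abs_mul]
        gcongr
        exact norm_le_pi_norm φ r
    _ = ‖φ‖ * ∑ r, |G.gen α β t (Pi.single r 1) s| := by rw [Finset.mul_sum]
    _ ≤ ‖φ‖ * C := by
        gcongr
        have h1 := Finset.single_le_sum (f := fun s => ∑ r, |G.gen α β t (Pi.single r 1) s|)
          (fun q _ => Finset.sum_nonneg fun r _ => abs_nonneg (G.gen α β t (Pi.single r 1) q))
          (Finset.mem_univ s)
        have h2 := hC t ht
        rw [Real.norm_eq_abs] at h2
        exact h1.trans ((le_abs_self _).trans h2)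
    _ = C * ‖φ‖ := mul_comm _ _

/-! ### The law of the chain -/

/-- The projection of the real line to `[0, M]`. -/
noncomputable def clip (M x : ℝ) : ℝ := max 0 (min x M)

theorem clip_nonneg (M x : ℝ) : 0 ≤ clip M x := le_max_left _ _

theorem clip_le {M : ℝ} (hM : 0 ≤ M) (x : ℝ) : clip M x ≤ M := max_le hM (min_le_right _ _)

theorem clip_of_mem {M x : ℝ} (h0 : 0 ≤ x) (h1 : x ≤ M) : clip M x = x := by
  rw [clip, min_eq_left h1, max_eq_right h0]

theorem clip_of_neg {M x : ℝ} (h0 : x < 0) : clip M x = 0 :=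
  max_eq_left ((min_le_left _ _).trans h0.le)

theorem clip_of_gt {M x : ℝ} (hM : 0 ≤ M) (h : M < x) : clip M x = M := by
  rw [clip, min_eq_right h.le, max_eq_right hM]

theorem abs_clip_sub_le (M x y : ℝ) : |clip M x - clip M y| ≤ |x - y| := by
  have h1 := abs_max_sub_max_le_max 0 (min x M) 0 (min y M)
  have h2 := abs_min_sub_min_le_max x M y M
  simp only [sub_self, abs_zero, abs_nonneg, sup_of_le_right, sup_of_le_left] at h1 h2
  exact h1.trans h2

/-- The forward equation with truncated probabilities has a solution. -/
theorem exists_truncated_forward_solution {α β : Control k N} (hα : G.IsFeedback α) (hβ : G.IsFeedback β) {t : ℝ}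
    (ht : t ∈ Icc 0 G.T) (s : State k N) :
    ∃ p : ℝ → State k N → ℝ, p t = Pi.single s 1 ∧ ∀ r, ∀ u ∈ Icc t G.T,
      HasDerivWithinAt (fun w => p w r)
        (∑ q, clip 1 (p u q) * G.gen α β u (Pi.single r 1) q) (Icc t G.T) u := by
  obtain ⟨C, hC, hgen⟩ := exists_gen_bound hα hβ
  have hsub : Icc t G.T ⊆ Icc 0 G.T := Icc_subset_Icc_left ht.1
  have hsingle : ∀ u ∈ Icc t G.T, ∀ r q, |G.gen α β u (Pi.single r 1) q| ≤ C := fun u hu r q => by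
    refine (hgen u (hsub hu) _ q).trans (mul_le_of_le_one_right hC ?_)
    simp [Pi.norm_single]
  set n : ℝ := ((Fintype.card (State k N) : ℕ) : ℝ) with hn_def
  set f : ℝ → (State k N → ℝ) → State k N → ℝ :=
    fun u p r => ∑ q, clip 1 (p q) * G.gen α β u (Pi.single r 1) q with hf
  have hn : 0 ≤ n := Nat.cast_nonneg _
  obtain ⟨p, hp0, hp⟩ := exists_solution_of_lipschitz_bounded (f := f)
    (left_mem_Icc.2 ht.2) (Pi.single s 1) (K := (n * C).toNNReal) (L := (n * C).toNNReal)
    (fun u hu => LipschitzWith.of_dist_le_mul fun x y => by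
      rw [dist_eq_norm, dist_eq_norm, Real.coe_toNNReal _ (mul_nonneg hn hC),
        pi_norm_le_iff_of_nonneg (by positivity)]
      intro r
      simp only [hf, Pi.sub_apply, ← Finset.sum_sub_distrib, ← sub_mul, Real.norm_eq_abs]
      calc _ ≤ ∑ q, |(clip 1 (x q) - clip 1 (y q)) * G.gen α β u (Pi.single r 1) q| :=
            Finset.abs_sum_le_sum_abs _ _
        _ ≤ ∑ _q : State k N, ‖x - y‖ * C := by
            refine Finset.sum_le_sum fun q _ => ?_
            rw [abs_mul]
            exact mul_le_mul ((abs_clip_sub_le 1 _ _).trans (norm_le_pi_norm (x - y) q))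
              (hsingle u hu r q) (abs_nonneg _) (norm_nonneg _)
        _ = n * C * ‖x - y‖ := by simp [hn_def]; ring)
    (fun x => continuousOn_pi.2 fun r => continuousOn_finsetSum _ fun q _ =>
      continuousOn_const.mul
        ((continuousOn_gen_const hα hβ (Pi.single r 1) q).mono hsub))
    (fun u hu x => by
      rw [Real.coe_toNNReal _ (mul_nonneg hn hC), pi_norm_le_iff_of_nonneg (by positivity)]
      intro r
      simp only [hf, Real.norm_eq_abs]
      calc _ ≤ ∑ q, |clip 1 (x q) * G.gen α β u (Pi.single r 1) q| :=
            Finset.abs_sum_le_sum_abs _ _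
        _ ≤ ∑ _q : State k N, 1 * C := by
            refine Finset.sum_le_sum fun q _ => ?_
            rw [abs_mul, abs_of_nonneg (clip_nonneg _ _)]
            exact mul_le_mul (clip_le zero_le_one _) (hsingle u hu r q) (abs_nonneg _) zero_le_one
        _ = n * C := by simp [hn_def])
  exact ⟨p, hp0, fun r u hu => hasDerivWithinAt_pi.1 (hp u hu) r⟩

/-- The truncated solution turns out to be a probability vector, so the truncation to [0, 1] never
acts and the true forward equation holds. -/
theorem exists_isLaw {α β : Control k N} (hα : G.IsFeedback α) (hβ : G.IsFeedback β) {t : ℝ}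
    (ht : t ∈ Icc 0 G.T) (s : State k N) : ∃ p, G.IsLaw α β t s p := by
  have hsub : Icc t G.T ⊆ Icc 0 G.T := Icc_subset_Icc_left ht.1
  obtain ⟨p, hp0, hpr⟩ := exists_truncated_forward_solution hα hβ ht s
  have hnonneg : ∀ r, ∀ u ∈ Icc t G.T, 0 ≤ p u r := by
    intro r
    refine nonneg_of_deriv_nonneg_of_neg (hpr r) ?_ ?_
    · rw [hp0]
      by_cases h : r = s
      · subst h; simp
      · simp [h]
    · intro u hu hneg
      refine Finset.sum_nonneg fun q _ => ?_
      -- Where `p u r` is negative, truncation removes the diagonal term, the only one whose rate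
      -- can be negative.
      by_cases h : q = r
      · subst h
        rw [clip_of_neg hneg, zero_mul]
      · refine mul_nonneg (clip_nonneg _ _) (gen_nonneg_of_min hα hβ (hsub hu) fun q' => ?_)
        rw [Pi.single_eq_of_ne h]
        by_cases h' : q' = r
        · subst h'; simp
        · simp [h']
  have hsum : ∀ u ∈ Icc t G.T, ∑ r, p u r = 1 := by
    have hd : ∀ u ∈ Icc t G.T, HasDerivWithinAt (fun w => ∑ r, p w r) 0 (Icc t G.T) u := by
      intro u hu
      have h1 := HasDerivWithinAt.fun_sum (u := Finset.univ) fun r _ => hpr r u hu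
      -- Mass is conserved even under truncation, since the generator kills constants.
      have h2 : ∑ r, ∑ q, clip 1 (p u q) * G.gen α β u (Pi.single r 1) q = 0 := by
        rw [Finset.sum_comm]
        simp only [← Finset.mul_sum, sum_gen_single, mul_zero, Finset.sum_const_zero]
      rwa [h2] at h1
    intro u hu
    have h1 := constant_of_has_deriv_right_zero (f := fun w => ∑ r, p w r)
      (fun u hu => (hd u hu).continuousWithinAt)
      (fun u hu => (hd u (Ico_subset_Icc_self hu)).mono_of_mem_nhdsWithin
        (Icc_mem_nhdsGE_of_mem hu)) u hu
    rw [h1, hp0]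
    simp
  refine ⟨p, hp0, fun u hu r => hnonneg r u hu, hsum, fun φ u hu => ?_⟩
  have hle : ∀ r, p u r ≤ 1 := fun r => by
    rw [← hsum u hu]
    exact Finset.single_le_sum (fun r _ => hnonneg r u hu) (Finset.mem_univ r)
  have h1 := HasDerivWithinAt.fun_sum (u := Finset.univ)
    fun r _ => (hpr r u hu).mul_const (φ r)
  refine h1.congr_deriv ?_
  simp only [Finset.sum_mul]
  rw [Finset.sum_comm]
  refine Finset.sum_congr rfl fun q _ => ?_
  rw [gen_eq_sum, Finset.mul_sum]
  refine Finset.sum_congr rfl fun r _ => ?_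
  rw [clip_of_mem (hnonneg q u hu) (hle q)]
  ring

theorem law_spec {α β : Control k N} (hα : G.IsFeedback α) (hβ : G.IsFeedback β) {t : ℝ}
    (ht : t ∈ Icc 0 G.T) (s : State k N) : G.IsLaw α β t s (G.law α β t s) :=
  Classical.epsilon_spec (exists_isLaw hα hβ ht s)

end Game

namespace Game

variable {k N : ℕ} (G : Game k N)

/-! ### The Hamilton-Jacobi-Bellman equation -/

theorem diff_sub (φ ψ : State k N → ℝ) (s : State k N) :
    diff (φ - ψ) s = diff φ s - diff ψ s := by
  ext j
  simp only [diff, Pi.sub_apply, PiLp.sub_apply]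
  ring

theorem exists_diff_bound (k N : ℕ) : ∃ C : ℝ, 0 ≤ C ∧ ∀ (φ : State k N → ℝ) (s : State k N),
    ‖diff φ s‖ ≤ C * ‖φ‖ := by
  have h : ∀ s : State k N, ∃ C : ℝ, 0 ≤ C ∧ ∀ φ : State k N → ℝ, ‖diff φ s‖ ≤ C * ‖φ‖ := by
    intro s
    let L : (State k N → ℝ) →ₗ[ℝ] Rates k :=
      { toFun := fun φ => diff φ s
        map_add' := fun φ ψ => by
          ext j
          simp only [diff, Pi.add_apply, PiLp.add_apply]
          ring
        map_smul' := fun c φ => by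
          ext j
          simp only [diff, Pi.smul_apply, PiLp.smul_apply, smul_eq_mul, RingHom.id_apply]
          ring }
    exact ⟨‖L.toContinuousLinearMap‖, norm_nonneg _, L.toContinuousLinearMap.le_opNorm⟩
  choose C hC0 hC using h
  refine ⟨∑ s, C s, Finset.sum_nonneg fun s _ => hC0 s, fun φ s => (hC s φ).trans ?_⟩
  gcongr
  exact Finset.single_le_sum (fun s _ => hC0 s) (Finset.mem_univ s)

theorem continuousOn_diff {φ : ℝ → State k N → ℝ} {S : Set ℝ}
    (hφ : ∀ s, ContinuousOn (fun t => φ t s) S) (s : State k N) :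
    ContinuousOn (fun t => diff (φ t) s) S :=
  (PiLp.continuous_toLp 2 _).comp_continuousOn
    (continuousOn_pi.2 fun _ => (hφ _).sub (hφ s))

/-- The right-hand side of the Hamilton-Jacobi-Bellman equation. -/
noncomputable def hjbRate (β : Control k N) (t : ℝ) (φ : State k N → ℝ) (s : State k N) : ℝ :=
  G.minCost s (diff φ s) + G.gen 0 β t φ s

variable {G}

theorem exists_hjbRate_lipschitz {β : Control k N} (hβ : G.IsFeedback β) {M : ℝ} (hM : 0 ≤ M) :
    ∃ K : ℝ, 0 ≤ K ∧ ∀ t ∈ Icc 0 G.T, ∀ φ ψ : State k N → ℝ, ‖φ‖ ≤ M → ‖ψ‖ ≤ M →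
      ∀ s, |G.hjbRate β t φ s - G.hjbRate β t ψ s| ≤ K * ‖φ - ψ‖ := by
  obtain ⟨D, hD, hdiff⟩ := exists_diff_bound k N
  obtain ⟨C, hC, hgen⟩ := exists_gen_bound isFeedback_zero hβ
  obtain ⟨c, hc, hmin⟩ := G.exists_minCost_lipschitz (D * M) (by positivity)
  refine ⟨c * D + C, by positivity, fun t ht φ ψ hφ hψ s => ?_⟩
  have h1 := hmin s (diff φ s) (diff ψ s) ((hdiff φ s).trans (by gcongr))
    ((hdiff ψ s).trans (by gcongr))
  have h2 := hgen t ht (φ - ψ) s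
  have h3 := hdiff (φ - ψ) s
  rw [gen_sub] at h2
  rw [diff_sub] at h3
  have h4 : G.hjbRate β t φ s - G.hjbRate β t ψ s
      = (G.minCost s (diff φ s) - G.minCost s (diff ψ s))
        + (G.gen 0 β t φ s - G.gen 0 β t ψ s) := by
    simp only [hjbRate]
    ring
  rw [h4]
  calc _ ≤ _ := abs_add_le _ _
    _ ≤ c * (D * ‖φ - ψ‖) + C * ‖φ - ψ‖ := add_le_add (h1.trans (by gcongr)) h2
    _ = _ := by ring

theorem exists_hjbRate_bound {β : Control k N} (hβ : G.IsFeedback β) {M : ℝ} (hM : 0 ≤ M) :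
    ∃ L : ℝ, 0 ≤ L ∧ ∀ t ∈ Icc 0 G.T, ∀ φ : State k N → ℝ, ‖φ‖ ≤ M →
      ∀ s, |G.hjbRate β t φ s| ≤ L := by
  obtain ⟨K, hK, h⟩ := exists_hjbRate_lipschitz hβ hM
  set A := ∑ s, |G.minCost s 0|
  have hA : 0 ≤ A := Finset.sum_nonneg fun _ _ => abs_nonneg _
  refine ⟨K * M + A, by positivity, fun t ht φ hφ s => ?_⟩
  have h1 := h t ht φ 0 hφ (by simpa using hM) s
  -- The bound comes from comparison with the zero function, where only the Hamiltonian survives.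
  have h2 : G.hjbRate β t 0 s = G.minCost s 0 := by
    have hd : diff (0 : State k N → ℝ) s = 0 := by ext j; simp [diff]
    simp [hjbRate, hd, gen, genX, genMu]
  have h3 : |G.minCost s 0| ≤ A :=
    Finset.single_le_sum (f := fun s => |G.minCost s 0|) (fun _ _ => abs_nonneg _)
      (Finset.mem_univ s)
  rw [h2, sub_zero] at h1
  have h4 := abs_add_le (G.hjbRate β t φ s - G.minCost s 0) (G.minCost s 0)
  rw [sub_add_cancel] at h4
  have h5 : K * ‖φ‖ ≤ K * M := by gcongr
  linarith

theorem continuousOn_hjbRate {β : Control k N} (hβ : G.IsFeedback β)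
    {φ : ℝ → State k N → ℝ} (hφ : ∀ s, ContinuousOn (fun t => φ t s) (Icc 0 G.T))
    (s : State k N) : ContinuousOn (fun t => G.hjbRate β t (φ t) s) (Icc 0 G.T) :=
  ((G.continuous_minCost s).comp_continuousOn (continuousOn_diff hφ s)).add
    (continuousOn_gen isFeedback_zero hβ subset_rfl hφ s)

variable (G)

/-- A bound on the cost of not using any control, from time `t` on. -/
noncomputable def valueCap (t : ℝ) : ℝ := ∑ s, G.term s + (∑ s, G.cost s 0) * (G.T - t)

theorem cost_zero_nonneg (s : State k N) : 0 ≤ G.cost s 0 :=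
  G.cost_nonneg s 0 (zero_mem_orthant k)

theorem valueCap_nonneg {t : ℝ} (ht : t ∈ Icc 0 G.T) : 0 ≤ G.valueCap t :=
  add_nonneg (Finset.sum_nonneg fun s _ => G.term_nonneg s)
    (mul_nonneg (Finset.sum_nonneg fun s _ => G.cost_zero_nonneg s) (sub_nonneg.2 ht.2))

theorem valueCap_le {t : ℝ} (ht : t ∈ Icc 0 G.T) : G.valueCap t ≤ G.valueCap 0 := by
  have : 0 ≤ ∑ s, G.cost s 0 := Finset.sum_nonneg fun s _ => G.cost_zero_nonneg s
  unfold valueCap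
  gcongr
  exact ht.1

/-- The bounded Lipschitz solutions of the Hamilton-Jacobi-Bellman equation. -/
structure IsHJB (β : Control k N) (V : ℝ → State k N → ℝ) : Prop where
  terminal : V G.T = G.term
  deriv : ∀ s, ∀ t ∈ Icc 0 G.T,
    HasDerivWithinAt (fun t => V t s) (-G.hjbRate β t (V t) s) (Icc 0 G.T) t
  mem : ∀ t ∈ Icc 0 G.T, ∀ s, V t s ∈ Icc 0 (G.valueCap 0)
  lipschitz : ∃ K : NNReal, ∀ s, LipschitzOnWith K (fun t => V t s) (Icc 0 G.T)

variable {G}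

theorem norm_clip_le {M : ℝ} (hM : 0 ≤ M) (x : State k N → ℝ) : ‖fun r => clip M (x r)‖ ≤ M :=
  (pi_norm_le_iff_of_nonneg hM).2 fun r => by
    rw [Real.norm_eq_abs, abs_of_nonneg (clip_nonneg _ _)]
    exact clip_le hM _

theorem norm_clip_sub_le (M : ℝ) (x y : State k N → ℝ) :
    ‖(fun r => clip M (x r)) - fun r => clip M (y r)‖ ≤ ‖x - y‖ :=
  (pi_norm_le_iff_of_nonneg (norm_nonneg _)).2 fun r =>
    (abs_clip_sub_le M _ _).trans (norm_le_pi_norm (x - y) r)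

/-- The Hamilton-Jacobi-Bellman equation with truncated values has a solution. -/
theorem exists_truncated_hjb {β : Control k N} (hβ : G.IsFeedback β) :
    ∃ V : ℝ → State k N → ℝ, V G.T = G.term ∧ ∀ s, ∀ t ∈ Icc 0 G.T,
      HasDerivWithinAt (fun t => V t s)
        (-G.hjbRate β t (fun r => clip (G.valueCap t) (V t r)) s) (Icc 0 G.T) t := by
  have h0 : (0 : ℝ) ∈ Icc 0 G.T := left_mem_Icc.2 G.T_pos.le
  have hM := G.valueCap_nonneg h0
  obtain ⟨K, hK, hlip⟩ := exists_hjbRate_lipschitz hβ hM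
  obtain ⟨L, hL, hbd⟩ := exists_hjbRate_bound hβ hM
  have hcl : ∀ t ∈ Icc 0 G.T, ∀ x : State k N → ℝ,
      ‖fun r => clip (G.valueCap t) (x r)‖ ≤ G.valueCap 0 := fun t ht x =>
    (norm_clip_le (G.valueCap_nonneg ht) x).trans (G.valueCap_le ht)
  set f : ℝ → (State k N → ℝ) → State k N → ℝ :=
    fun t x s => -G.hjbRate β t (fun r => clip (G.valueCap t) (x r)) s
  have hf1 : ∀ t ∈ Icc 0 G.T, LipschitzWith K.toNNReal (f t) := fun t ht =>
    LipschitzWith.of_dist_le_mul fun x y => by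
      rw [dist_eq_norm, dist_eq_norm, Real.coe_toNNReal _ hK]
      refine (pi_norm_le_iff_of_nonneg (by positivity)).2 fun s => ?_
      rw [Pi.sub_apply, neg_sub_neg, norm_sub_rev]
      refine (hlip t ht _ _ (hcl t ht x) (hcl t ht y) s).trans ?_
      gcongr
      exact norm_clip_sub_le _ x y
  have hf2 : ∀ x, ContinuousOn (fun t => f t x) (Icc 0 G.T) := fun x => by
    have hc : ∀ r, ContinuousOn (fun t => clip (G.valueCap t) (x r)) (Icc 0 G.T) := fun r => by
      unfold clip valueCap
      fun_prop
    exact continuousOn_pi.2 fun s => (continuousOn_hjbRate hβ hc s).neg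
  have hf3 : ∀ t ∈ Icc 0 G.T, ∀ x, ‖f t x‖ ≤ L.toNNReal := fun t ht x => by
    rw [Real.coe_toNNReal _ hL]
    refine (pi_norm_le_iff_of_nonneg hL).2 fun s => ?_
    rw [norm_neg]
    exact hbd t ht _ (hcl t ht x) s
  obtain ⟨V, hVT, hV⟩ :=
    exists_solution_of_lipschitz_bounded (right_mem_Icc.2 G.T_pos.le) G.term hf1 hf2 hf3
  exact ⟨V, hVT, fun s t ht => hasDerivWithinAt_pi.1 (hV t ht) s⟩

/-- The constants 0 and `valueCap` act as lower and upper barriers for the truncated equation, so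
its solution stays where the truncation is the identity. -/
theorem exists_isHJB {β : Control k N} (hβ : G.IsFeedback β) : ∃ V, G.IsHJB β V := by
  obtain ⟨V, hVT, hV⟩ := exists_truncated_hjb hβ
  have h0 : ∀ s, ∀ t ∈ Icc 0 G.T, 0 ≤ V t s := by
    intro s
    -- If `V t s < 0`, the truncated function is 0 at `s`, its minimum; all its differences from `s`
    -- are then nonnegative and both parts of the right-hand side are too.
    refine nonneg_of_deriv_nonpos_of_neg (hV s) (by rw [hVT]; exact G.term_nonneg s)
      fun t ht hneg => neg_nonpos.2 (add_nonneg (G.minCost_nonneg s fun j => ?_)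
        (gen_nonneg_of_min isFeedback_zero hβ ht fun r => ?_))
    · simpa [diff, clip_of_neg hneg] using clip_nonneg _ _
    · simpa [clip_of_neg hneg] using clip_nonneg _ _
  have h1 : ∀ s, ∀ t ∈ Icc 0 G.T, V t s ≤ G.valueCap t := by
    intro s t ht
    rw [← sub_nonneg]
    have hd : ∀ t ∈ Icc 0 G.T, HasDerivWithinAt (fun t => G.valueCap t - V t s)
        ((∑ s, G.cost s 0) * (-1) -
          -G.hjbRate β t (fun r => clip (G.valueCap t) (V t r)) s) (Icc 0 G.T) t := by
      intro t ht
      refine HasDerivWithinAt.sub ?_ (hV s t ht)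
      exact (((hasDerivWithinAt_id t _).const_sub G.T).const_mul _).const_add _
    refine nonneg_of_deriv_nonpos_of_neg hd ?_ (fun t ht hneg => ?_) t ht
    · rw [hVT]
      simp only [valueCap, sub_self, mul_zero, add_zero, sub_nonneg]
      exact Finset.single_le_sum (fun s _ => G.term_nonneg s) (Finset.mem_univ s)
    -- Above the cap, the truncated function is maximal at `s`, so the generator is nonpositive
    -- there, and the zero control bounds the minimal cost by the rate at which the cap decreases.
    · have hcap := G.valueCap_nonneg ht
      have h2 : G.gen 0 β t (fun r => clip (G.valueCap t) (V t r)) s ≤ 0 :=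
        gen_nonpos_of_max isFeedback_zero hβ ht fun r => by
          rw [clip_of_gt hcap (sub_neg.1 hneg)]
          exact clip_le hcap _
      have h3 := G.minCost_le_cost_zero s (diff (fun r => clip (G.valueCap t) (V t r)) s)
      have h4 : G.cost s 0 ≤ ∑ s, G.cost s 0 :=
        Finset.single_le_sum (fun s _ => G.cost_zero_nonneg s) (Finset.mem_univ s)
      unfold hjbRate
      linarith
  have hclip : ∀ t ∈ Icc 0 G.T, (fun r => clip (G.valueCap t) (V t r)) = V t := fun t ht =>
    funext fun r => clip_of_mem (h0 r t ht) (h1 r t ht)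
  have hd : ∀ s, ∀ t ∈ Icc 0 G.T,
      HasDerivWithinAt (fun t => V t s) (-G.hjbRate β t (V t) s) (Icc 0 G.T) t := by
    intro s t ht
    have := hV s t ht
    rwa [hclip t ht] at this
  have hcap := G.valueCap_nonneg (left_mem_Icc.2 G.T_pos.le)
  have hmem : ∀ t ∈ Icc 0 G.T, ∀ s, V t s ∈ Icc 0 (G.valueCap 0) := fun t ht s =>
    ⟨h0 s t ht, (h1 s t ht).trans (G.valueCap_le ht)⟩
  obtain ⟨L, hL, hbd⟩ := exists_hjbRate_bound hβ hcap
  refine ⟨V, hVT, hd, hmem, L.toNNReal, fun s =>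
    (convex_Icc 0 G.T).lipschitzOnWith_of_nnnorm_hasDerivWithin_le (hd s) fun t ht => ?_⟩
  rw [← NNReal.coe_le_coe, coe_nnnorm, norm_neg, Real.coe_toNNReal _ hL]
  refine hbd t ht _ ((pi_norm_le_iff_of_nonneg hcap).2 fun r => ?_) s
  rw [Real.norm_eq_abs, abs_of_nonneg (hmem t ht r).1]
  exact (hmem t ht r).2

theorem IsHJB.continuousOn {β : Control k N} {V : ℝ → State k N → ℝ} (h : G.IsHJB β V)
    (s : State k N) : ContinuousOn (fun t => V t s) (Icc 0 G.T) :=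
  fun t ht => (h.deriv s t ht).continuousWithinAt

/-- The minimizing feedback of a solution is admissible. -/
theorem IsHJB.argmin_admissible {β : Control k N} {V : ℝ → State k N → ℝ} (h : G.IsHJB β V) :
    (fun t s => G.argmin s (diff (V t) s)) ∈ G.admissible := by
  obtain ⟨c, hc, hlip⟩ := G.exists_argmin_lipschitz
  obtain ⟨D, hD, hdiff⟩ := exists_diff_bound k N
  obtain ⟨K, hK⟩ := h.lipschitz
  refine ⟨fun t _ s => G.argmin_mem s _, (c * (D * K)).toNNReal, fun s =>
    LipschitzOnWith.of_dist_le_mul fun t ht u hu => ?_⟩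
  rw [dist_eq_norm, Real.coe_toNNReal _ (by positivity)]
  refine (hlip s _ _).trans ?_
  rw [← diff_sub, mul_assoc, mul_assoc]
  gcongr
  refine (hdiff _ s).trans ?_
  gcongr
  refine (pi_norm_le_iff_of_nonneg (by positivity)).2 fun r => ?_
  rw [Pi.sub_apply, ← dist_eq_norm]
  exact (hK r).dist_le_mul t ht u hu

/-! ### Verification -/

/-- Dynkin's formula for a time-dependent function: the product rule, with the forward equation
tested on indicators. -/
theorem IsLaw.hasDerivWithinAt {α β : Control k N} {t : ℝ} {s : State k N}
    {p V V' : ℝ → State k N → ℝ} (h : G.IsLaw α β t s p)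
    (hV : ∀ r, ∀ u ∈ Icc t G.T, HasDerivWithinAt (fun w => V w r) (V' u r) (Icc t G.T) u) :
    ∀ u ∈ Icc t G.T, HasDerivWithinAt (fun w => ∑ r, p w r * V w r)
      (∑ r, p u r * (G.gen α β u (V u) r + V' u r)) (Icc t G.T) u := by
  intro u hu
  have hp : ∀ r, HasDerivWithinAt (fun w => p w r)
      (∑ q, p u q * G.gen α β u (Pi.single r 1) q) (Icc t G.T) u := fun r => by
    have := h.forward (Pi.single r 1) u hu
    simpa [Pi.single_apply] using this
  refine (HasDerivWithinAt.fun_sum (u := Finset.univ)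
    fun r _ => (hp r).mul (hV r u hu)).congr_deriv ?_
  simp only [mul_add, Finset.sum_add_distrib, Finset.sum_mul]
  congr 1
  rw [Finset.sum_comm]
  refine Finset.sum_congr rfl fun q _ => ?_
  rw [gen_eq_sum, Finset.mul_sum]
  exact Finset.sum_congr rfl fun r _ => by ring

theorem IsLaw.continuousOn {α β : Control k N} {t : ℝ} {s : State k N} {p : ℝ → State k N → ℝ}
    (h : G.IsLaw α β t s p) (r : State k N) : ContinuousOn (fun u => p u r) (Icc t G.T) := by
  intro u hu
  have := (h.forward (Pi.single r 1) u hu).continuousWithinAt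
  simpa [Pi.single_apply] using this

theorem continuousOn_cost {α : Control k N} (hα : G.IsFeedback α) (r : State k N) :
    ContinuousOn (fun u => G.cost r (α u r)) (Icc 0 G.T) :=
  (G.cost_continuous r).comp (hα.2 r) fun u hu => hα.1 u hu r

/-- The tagged player's control enters the generator linearly, through exactly the term that the
Hamiltonian minimizes. -/
theorem gen_eq_gen_zero_add (α β : Control k N) (t : ℝ) (φ : State k N → ℝ) (s : State k N) :
    G.gen α β t φ s = G.gen 0 β t φ s + G.pairing s (α t s) (diff φ s) := by
  have : G.genX α t φ s = G.genX 0 t φ s + G.pairing s (α t s) (diff φ s) := by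
    simp only [genX, pairing, diff, rate, ← Finset.sum_add_distrib]
    refine Finset.sum_congr rfl fun j _ => ?_
    simp
    ring
  simp only [gen, this]
  ring

/-- Against any control, the solution of the Hamilton-Jacobi-Bellman equation for `β` is at most
the cost, up to the effect of the replacement of `β` by `β'`. -/
theorem IsHJB.le_J_add {α β β' : Control k N} {V : ℝ → State k N → ℝ} (h : G.IsHJB β V)
    (hα : G.IsFeedback α) (hβ' : G.IsFeedback β') {D : ℝ → ℝ}
    (hDc : ContinuousOn D (Icc 0 G.T))
    (hD : ∀ u ∈ Icc 0 G.T, ∀ r, G.genMu β u (V u) r - G.genMu β' u (V u) r ≤ D u)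
    {t : ℝ} (ht : t ∈ Icc 0 G.T) (s : State k N) :
    V t s ≤ G.J t s α β' + ∫ u in t..G.T, D u := by
  have hlaw := law_spec hα hβ' ht s
  set p := G.law α β' t s
  have hsub : Icc t G.T ⊆ Icc 0 G.T := Icc_subset_Icc_left ht.1
  have hder := hlaw.hasDerivWithinAt fun r u hu => (h.deriv r u (hsub hu)).mono hsub
  have hcost : ContinuousOn (fun u => ∑ r, p u r * G.cost r (α u r)) (Icc t G.T) :=
    continuousOn_finsetSum _ fun r _ => (hlaw.continuousOn r).mul
      ((continuousOn_cost hα r).mono hsub)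
  have hD' := hDc.mono hsub
  -- Along the chain driven by `α` and `β'`, the mean of `V` has derivative at least -(mean cost +
  -- `D`): `minCost` is at most the cost of `α`, and `D` pays for the mismatch between `β` and `β'`.
  have key := intervalIntegral.integral_le_sub_of_hasDeriv_right_of_le ht.2
    (fun u hu => (hder u hu).continuousWithinAt)
    (fun u hu => ((hder u (Ioo_subset_Icc_self hu)).hasDerivAt
      (Icc_mem_nhds hu.1 hu.2)).hasDerivWithinAt)
    (φ := fun u => -((∑ r, p u r * G.cost r (α u r)) + D u))
    ((hcost.add hD').neg.integrableOn_Icc) (fun u hu => by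
      have hu' := Ioo_subset_Icc_self hu
      have h1 : D u = ∑ r, p u r * D u := by rw [← Finset.sum_mul, hlaw.sum_one u hu', one_mul]
      rw [h1, ← Finset.sum_add_distrib, ← Finset.sum_neg_distrib]
      refine Finset.sum_le_sum fun r _ => ?_
      have h2 := G.minCost_le r (diff (V u) r) (hα.1 u (hsub hu') r)
      have h3 := hD u (hsub hu') r
      have h4 : G.gen 0 β' u (V u) r - G.gen 0 β u (V u) r
          = G.genMu β' u (V u) r - G.genMu β u (V u) r := by
        simp only [gen]
        ring
      have h5 := hlaw.nonneg u hu' r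
      rw [gen_eq_gen_zero_add, ← mul_add, ← mul_neg]
      unfold hjbRate
      exact mul_le_mul_of_nonneg_left (by linarith) h5)
  rw [intervalIntegral.integral_neg, intervalIntegral.integral_add
    (hcost.intervalIntegrable_of_Icc ht.2) (hD'.intervalIntegrable_of_Icc ht.2), hlaw.init,
    h.terminal] at key
  have h6 : ∑ r, (Pi.single s 1 : State k N → ℝ) r * V t r = V t s := by simp [Pi.single_apply]
  rw [h6] at key
  unfold J
  linarith

/-- The minimizing feedback attains the solution of the Hamilton-Jacobi-Bellman equation. -/
theorem IsHJB.J_argmin_le {β : Control k N} {V : ℝ → State k N → ℝ} (h : G.IsHJB β V)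
    (hβ : G.IsFeedback β) {t : ℝ} (ht : t ∈ Icc 0 G.T) (s : State k N) :
    G.J t s (fun t s => G.argmin s (diff (V t) s)) β ≤ V t s := by
  set α : Control k N := fun t s => G.argmin s (diff (V t) s) with hα_def
  have hα : G.IsFeedback α := isFeedback_of_admissible h.argmin_admissible
  have hlaw := law_spec hα hβ ht s
  set p := G.law α β t s
  have hsub : Icc t G.T ⊆ Icc 0 G.T := Icc_subset_Icc_left ht.1
  have hder := hlaw.hasDerivWithinAt fun r u hu => (h.deriv r u (hsub hu)).mono hsub
  have hcost : ContinuousOn (fun u => ∑ r, p u r * G.cost r (α u r)) (Icc t G.T) :=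
    continuousOn_finsetSum _ fun r _ => (hlaw.continuousOn r).mul
      ((continuousOn_cost hα r).mono hsub)
  -- For the minimizing feedback the derivative of the mean of `V` is exactly minus the mean cost.
  have key := intervalIntegral.sub_le_integral_of_hasDeriv_right_of_le ht.2
    (fun u hu => (hder u hu).continuousWithinAt)
    (fun u hu => ((hder u (Ioo_subset_Icc_self hu)).hasDerivAt
      (Icc_mem_nhds hu.1 hu.2)).hasDerivWithinAt)
    (φ := fun u => -(∑ r, p u r * G.cost r (α u r)))
    (hcost.neg.integrableOn_Icc) (fun u _ => by
      rw [← Finset.sum_neg_distrib]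
      refine Finset.sum_le_sum fun r _ => le_of_eq ?_
      rw [gen_eq_gen_zero_add]
      simp only [hjbRate, minCost, hα_def]
      ring)
  rw [intervalIntegral.integral_neg, hlaw.init, h.terminal] at key
  have h6 : ∑ r, (Pi.single s 1 : State k N → ℝ) r * V t r = V t s := by simp [Pi.single_apply]
  rw [h6] at key
  unfold J
  linarith

/-- The value function solves the Hamilton-Jacobi-Bellman equation. -/
theorem IsHJB.value_eq {β : Control k N} {V : ℝ → State k N → ℝ} (h : G.IsHJB β V)
    (hβ : G.IsFeedback β) {t : ℝ} (ht : t ∈ Icc 0 G.T) (s : State k N) :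
    G.value β t s = V t s := by
  have hlow : ∀ α : G.admissible, V t s ≤ G.J t s α β := by
    rintro ⟨α, hα⟩
    have h0 := h.le_J_add (isFeedback_of_admissible hα) hβ (D := fun _ => 0) continuousOn_const
      (fun u _ r => (sub_self _).le) ht s
    rwa [intervalIntegral.integral_zero, add_zero] at h0
  have hbdd : BddBelow (range fun α : G.admissible => G.J t s α β) :=
    ⟨V t s, forall_mem_range.2 hlow⟩
  have hne : Nonempty G.admissible := ⟨⟨_, h.argmin_admissible⟩⟩
  have hup := ciInf_le hbdd ⟨_, h.argmin_admissible⟩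
  exact le_antisymm (hup.trans (h.J_argmin_le hβ ht s)) (le_ciInf hlow)

/-- Keeps both iterations among the continuous feedbacks: on [0, T] the best response agrees with
the Lipschitz minimizing feedback of the HJB solution. -/
theorem isFeedback_bestResponse {β : Control k N} (hβ : G.IsFeedback β) :
    G.IsFeedback (G.bestResponse β) := by
  obtain ⟨V, hV⟩ := exists_isHJB hβ
  refine ⟨fun t _ s => G.argmin_mem s _, fun s =>
    ((isFeedback_of_admissible hV.argmin_admissible).2 s).congr fun t ht => ?_⟩
  have : G.value β t = V t := funext fun s => hV.value_eq hβ ht s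
  simp only [bestResponse, this]

/-! ### Dependence of the values on the control of the untagged players -/

/-- The factors count `k + 1` departure states with at most `N` players each; `lamSum` bounds the
rates summed over targets, and `M` bounds each increment of `φ`. -/
theorem genMu_sub_abs_le (β β' : Control k N) (t : ℝ) {φ : State k N → ℝ} {M : ℝ}
    (hφ : ∀ s, φ s ∈ Icc 0 M) (s : State k N) :
    |G.genMu β t φ s - G.genMu β' t φ s| ≤
      (k + 1) * N * G.lamSum * M * norm2 (fun r => β' t r - β t r) := by
  set b := norm2 (fun r => β' t r - β t r)
  have hb : 0 ≤ b := norm2_nonneg _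
  have hM : 0 ≤ M := (hφ s).1.trans (hφ s).2
  have hterm : ∀ z j, |(s.2.1 z : ℝ) * G.rate (z, s.2.move z s.1) (β t (z, s.2.move z s.1)) j *
        (φ (s.1, s.2.move z (z.succAbove j)) - φ s)
      - (s.2.1 z : ℝ) * G.rate (z, s.2.move z s.1) (β' t (z, s.2.move z s.1)) j *
        (φ (s.1, s.2.move z (z.succAbove j)) - φ s)|
      ≤ G.lam1 (z, s.2.move z s.1) j * (N * b * M) := by
    intro z j
    set q : State k N := (z, s.2.move z s.1)
    have hn : (s.2.1 z : ℝ) ≤ N := by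
      have : s.2.1 z ≤ N := by
        conv_rhs => rw [← s.2.2]
        exact Finset.single_le_sum (fun _ _ => Nat.zero_le _) (Finset.mem_univ z)
      exact_mod_cast this
    have hl := G.lam1_nonneg q j
    have hβ : |β t q j - β' t q j| ≤ b := by
      rw [abs_sub_comm]
      exact (abs_coord_le_norm (β' t q - β t q) j).trans
        (norm_le_norm2 (fun r => β' t r - β t r) q)
    set r : State k N := (s.1, s.2.move z (z.succAbove j))
    have hd : |φ r - φ s| ≤ M :=
      abs_le.2 ⟨by linarith [(hφ r).1, (hφ s).2], by linarith [(hφ r).2, (hφ s).1]⟩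
    have heq : (s.2.1 z : ℝ) * G.rate q (β t q) j * (φ r - φ s)
        - (s.2.1 z : ℝ) * G.rate q (β' t q) j * (φ r - φ s)
        = G.lam1 q j * ((s.2.1 z : ℝ) * (β t q j - β' t q j) * (φ r - φ s)) := by
      simp only [rate]
      ring
    rw [heq, abs_mul, abs_mul, abs_mul, abs_of_nonneg hl, Nat.abs_cast]
    gcongr
  unfold genMu
  simp only [← Finset.sum_sub_distrib]
  calc _ ≤ ∑ z : Fin (k + 1), ∑ j : Fin k, G.lam1 (z, s.2.move z s.1) j * (N * b * M) :=
        (Finset.abs_sum_le_sum_abs _ _).trans (Finset.sum_le_sum fun z _ =>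
          (Finset.abs_sum_le_sum_abs _ _).trans (Finset.sum_le_sum fun j _ => hterm z j))
    _ ≤ ∑ _z : Fin (k + 1), G.lamSum * (N * b * M) := by
        refine Finset.sum_le_sum fun z _ => ?_
        rw [← Finset.sum_mul]
        gcongr
        exact G.sum_lam1_le _
    _ = _ := by simp; ring

variable (G)

/-- The Lipschitz constant of the values as functions of the control. -/
noncomputable def valueLip : ℝ := (k + 1) * N * G.lamSum * G.valueCap 0

variable {G}

theorem value_le_add {β β' : Control k N} (hβ : G.IsFeedback β) (hβ' : G.IsFeedback β') {t : ℝ}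
    (ht : t ∈ Icc 0 G.T) (s : State k N) :
    G.value β t s ≤ G.value β' t s
      + G.valueLip * ∫ u in t..G.T, norm2 (fun r => β' u r - β u r) := by
  obtain ⟨V, hV⟩ := exists_isHJB hβ
  obtain ⟨V', hV'⟩ := exists_isHJB hβ'
  rw [hV.value_eq hβ ht, hV'.value_eq hβ' ht, ← intervalIntegral.integral_const_mul]
  -- The optimal feedback for `β'` is tested against the solution for `β`; its cost against `β'` is
  -- at most `V'`.
  have h1 := hV.le_J_add (isFeedback_of_admissible hV'.argmin_admissible) hβ'
    (D := fun u => G.valueLip * norm2 (fun r => β' u r - β u r))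
    (continuousOn_const.mul (continuousOn_norm2 fun r => (hβ'.2 r).sub (hβ.2 r)))
    (fun u hu r => (le_abs_self _).trans (genMu_sub_abs_le β β' u (hV.mem u hu) r)) ht s
  linarith [hV'.J_argmin_le hβ' ht s]

theorem sqNorm_value_sub_le {β β' : Control k N} (hβ : G.IsFeedback β) (hβ' : G.IsFeedback β')
    {t : ℝ} (ht : t ∈ Icc 0 G.T) :
    sqNorm (fun s => G.value β t s - G.value β' t s) ≤
      Fintype.card (State k N) * (G.valueLip ^ 2 * G.T) *
        ∫ u in t..G.T, sqNorm (fun s => β' u s - β u s) := by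
  have hc : ContinuousOn (fun u => norm2 (fun r => β' u r - β u r)) (Icc t G.T) :=
    (continuousOn_norm2 fun r => (hβ'.2 r).sub (hβ.2 r)).mono (Icc_subset_Icc_left ht.1)
  have h1 : ∀ s, ‖G.value β t s - G.value β' t s‖
      ≤ G.valueLip * ∫ u in t..G.T, norm2 (fun r => β' u r - β u r) := by
    intro s
    have ha := value_le_add hβ hβ' ht s
    have hb := value_le_add hβ' hβ ht s
    have hsymm : ∀ u, norm2 (fun r => β u r - β' u r) = norm2 (fun r => β' u r - β u r) :=
      fun u => by simp only [norm2, sqNorm, norm_sub_rev]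
    simp only [hsymm] at hb
    rw [Real.norm_eq_abs, abs_le]
    constructor <;> linarith
  refine (sqNorm_le_card_mul h1).trans ?_
  rw [mul_assoc]
  gcongr
  rw [mul_pow, mul_assoc]
  gcongr
  -- Cauchy-Schwarz produces the factor `T - t`, which is bounded by `T`.
  refine (sq_integral_le_mul_integral_sq ht.2 hc).trans ?_
  simp only [norm2_sq]
  refine mul_le_mul_of_nonneg_right (by linarith [ht.1]) ?_
  exact intervalIntegral.integral_nonneg ht.2 fun u _ => sqNorm_nonneg _

end Game

/-! ### The combinatorial sums -/

/-- The coefficient of the error made `i` steps ago in the bound for the controls. -/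
noncomputable def controlCoeff (ρ c : ℝ) (i : ℕ) (x : ℝ) : ℝ :=
  ∑ j ∈ Finset.range (i + 1), (i.choose j : ℝ) * ρ ^ (i - j) * (c ^ j * x ^ j / (j.factorial : ℝ))

/-- The coefficient of the error made `i` steps ago in the bound for the values. -/
noncomputable def valueCoeff (ρ c : ℝ) (i : ℕ) (x : ℝ) : ℝ :=
  ∑ j ∈ Finset.range (i + 1), (i.choose j : ℝ) * ρ ^ (i - j) *
    (c ^ (j + 1) * x ^ (j + 1) / ((j + 1).factorial : ℝ))

theorem sum_Icc_one_eq_sum_range (f : ℕ → ℝ) (m : ℕ) :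
    ∑ i ∈ Finset.Icc 1 m, f i = ∑ i ∈ Finset.range m, f (i + 1) := by
  rw [Finset.range_eq_Ico, Finset.sum_Ico_add' f 0 m 1]
  rfl

theorem controlCoeff_zero (ρ c x : ℝ) : controlCoeff ρ c 0 x = 1 := by simp [controlCoeff]

/-- Pascal's rule: `controlCoeff` is (ρ + c I)^i applied to 1, with I integration from 0 to `x`, and
`valueCoeff` is c I of it. -/
theorem controlCoeff_succ (ρ c : ℝ) (i : ℕ) (x : ℝ) :
    controlCoeff ρ c (i + 1) x = ρ * controlCoeff ρ c i x + valueCoeff ρ c i x := by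
  have h1 : ρ * controlCoeff ρ c i x = ∑ j ∈ Finset.range (i + 2),
      (i.choose j : ℝ) * ρ ^ (i + 1 - j) * (c ^ j * x ^ j / (j.factorial : ℝ)) := by
    -- The added term j = i + 1 has a vanishing binomial coefficient, so both sums range over the
    -- same indices.
    rw [Finset.sum_range_succ _ (i + 1), Nat.choose_succ_self, controlCoeff, Finset.mul_sum]
    simp only [Nat.cast_zero, zero_mul, add_zero]
    refine Finset.sum_congr rfl fun j hj => ?_
    rw [Nat.succ_sub (Nat.lt_succ_iff.1 (Finset.mem_range.1 hj)), pow_succ]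
    ring
  rw [h1, controlCoeff, valueCoeff, Finset.sum_range_succ' _ (i + 1),
    Finset.sum_range_succ' _ (i + 1), add_right_comm, ← Finset.sum_add_distrib]
  simp only [Nat.choose_zero_right]
  congr 1
  refine Finset.sum_congr rfl fun j _ => ?_
  rw [Nat.choose_succ_succ, Nat.succ_eq_add_one, Nat.add_sub_add_right]
  push_cast
  ring

theorem continuous_controlCoeff (ρ c : ℝ) (i : ℕ) : Continuous (controlCoeff ρ c i) := by
  unfold controlCoeff
  fun_prop

theorem integral_controlCoeff (ρ c : ℝ) (i : ℕ) (t T : ℝ) :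
    c * ∫ u in t..T, controlCoeff ρ c i (T - u) = valueCoeff ρ c i (T - t) := by
  rw [intervalIntegral.integral_comp_sub_left (fun u => controlCoeff ρ c i u), sub_self]
  unfold controlCoeff valueCoeff
  rw [intervalIntegral.integral_finsetSum
    fun j _ => Continuous.intervalIntegrable (by fun_prop) _ _, Finset.mul_sum]
  refine Finset.sum_congr rfl fun j _ => ?_
  rw [intervalIntegral.integral_const_mul, intervalIntegral.integral_div,
    intervalIntegral.integral_const_mul, integral_pow, Nat.factorial_succ]
  have h1 : (j.factorial : ℝ) ≠ 0 := Nat.cast_ne_zero.2 j.factorial_ne_zero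
  have h2 : (j : ℝ) + 1 ≠ 0 := by positivity
  push_cast
  simp only [ne_eq, Nat.add_eq_zero_iff, one_ne_zero, and_false, not_false_eq_true, zero_pow,
    sub_zero]
  field_simp
  ring

theorem gammaBound_eq (T c₀ cs ρ : ℝ) (e : ℕ → ℝ) (m : ℕ) (t : ℝ) :
    gammaBound T c₀ cs ρ e m t = cHat c₀ ρ *
      ∑ i ∈ Finset.range m, e (m - i) ^ 2 * controlCoeff ρ (cs * cHat c₀ ρ) i (T - t) := by
  simp only [gammaBound, sum_Icc_one_eq_sum_range, Nat.add_sub_add_right, Nat.add_sub_cancel]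
  rfl

theorem valueBound_succ_eq (T c₀ cs ρ : ℝ) (e : ℕ → ℝ) (m : ℕ) (t : ℝ) :
    valueBound T c₀ cs ρ e (m + 1) t =
      ∑ i ∈ Finset.range m, e (m - i) ^ 2 * valueCoeff ρ (cs * cHat c₀ ρ) i (T - t) := by
  simp only [valueBound, sum_Icc_one_eq_sum_range, Nat.add_sub_add_right, Nat.add_sub_cancel]
  rfl

/-- The recursion of `controlDev_succ_le` with equality: older errors age by one step through
`controlCoeff_succ`, and the newest enters with coefficient 1. -/
theorem gammaBound_succ (T c₀ cs ρ : ℝ) (e : ℕ → ℝ) (m : ℕ) (t : ℝ) :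
    gammaBound T c₀ cs ρ e (m + 1) t = ρ * gammaBound T c₀ cs ρ e m t +
      cHat c₀ ρ * (valueBound T c₀ cs ρ e (m + 1) t + e (m + 1) ^ 2) := by
  rw [gammaBound_eq, gammaBound_eq, valueBound_succ_eq, Finset.sum_range_succ',
    controlCoeff_zero]
  simp only [Nat.add_sub_add_right, controlCoeff_succ, Nat.sub_zero, mul_one, mul_add,
    Finset.sum_add_distrib, Finset.mul_sum, ← add_assoc]
  congr 3
  exact funext fun i => by ring

theorem continuous_gammaBound (T c₀ cs ρ : ℝ) (e : ℕ → ℝ) (m : ℕ) :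
    Continuous (gammaBound T c₀ cs ρ e m) := by
  have h : gammaBound T c₀ cs ρ e m = fun t => cHat c₀ ρ *
      ∑ i ∈ Finset.range m, e (m - i) ^ 2 * controlCoeff ρ (cs * cHat c₀ ρ) i (T - t) :=
    funext fun t => gammaBound_eq T c₀ cs ρ e m t
  rw [h]
  exact continuous_const.mul (continuous_finsetSum _ fun i _ => continuous_const.mul
    ((continuous_controlCoeff _ _ i).comp (continuous_const.sub continuous_id)))

theorem integral_gammaBound (T c₀ cs ρ : ℝ) (e : ℕ → ℝ) (m : ℕ) (t : ℝ) :
    cs * ∫ u in t..T, gammaBound T c₀ cs ρ e m u = valueBound T c₀ cs ρ e (m + 1) t := by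
  have hc : ∀ i, Continuous fun u => controlCoeff ρ (cs * cHat c₀ ρ) i (T - u) := fun i =>
    (continuous_controlCoeff _ _ i).comp (continuous_const.sub continuous_id)
  have hi : ∀ i ∈ Finset.range m, IntervalIntegrable
      (fun u => e (m - i) ^ 2 * controlCoeff ρ (cs * cHat c₀ ρ) i (T - u))
      MeasureTheory.volume t T := fun i _ => (continuous_const.mul (hc i)).intervalIntegrable _ _
  simp only [gammaBound_eq, valueBound_succ_eq, ← integral_controlCoeff]
  rw [intervalIntegral.integral_const_mul, intervalIntegral.integral_finsetSum hi, ← mul_assoc,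
    Finset.mul_sum]
  refine Finset.sum_congr rfl fun i _ => ?_
  rw [intervalIntegral.integral_const_mul]
  ring

theorem cHat_pos {ρ : ℝ} (h : ρ < 1) (c₀ : ℝ) : 0 < cHat c₀ ρ :=
  mul_pos (by linarith) (lt_max_of_lt_right one_pos)

namespace Game

variable {k N : ℕ} {G : Game k N}

/-! ### The iterations -/

variable (G) in
/-- The best response is Lipschitz in the value function. -/
theorem exists_response_lipschitz : ∃ c : ℝ, 0 < c ∧ ∀ (β β' : Control k N) (t : ℝ),
    norm2 (fun s => G.bestResponse β t s - G.bestResponse β' t s)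
      ≤ c * norm2 (fun s => G.value β t s - G.value β' t s) := by
  obtain ⟨c, hc, hlip⟩ := G.exists_argmin_lipschitz
  obtain ⟨D, hD, hdiff⟩ := exists_diff_bound k N
  -- The added 1 only ensures positivity.
  refine ⟨√(Fintype.card (State k N)) * (c * D) + 1, by positivity, fun β β' t => ?_⟩
  set n := norm2 (fun s => G.value β t s - G.value β' t s)
  have hn : 0 ≤ n := norm2_nonneg _
  have h1 : ∀ s, ‖G.bestResponse β t s - G.bestResponse β' t s‖ ≤ c * D * n := fun s => by
    refine (hlip s _ _).trans ?_
    rw [← diff_sub, mul_assoc]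
    gcongr
    refine (hdiff _ s).trans ?_
    gcongr
    exact (pi_norm_le_iff_of_nonneg hn).2
      fun r => norm_le_norm2 (fun s => G.value β t s - G.value β' t s) r
  calc norm2 (fun s => G.bestResponse β t s - G.bestResponse β' t s)
      ≤ √(Fintype.card (State k N) * (c * D * n) ^ 2) :=
        Real.sqrt_le_sqrt (sqNorm_le_card_mul h1)
    _ = √(Fintype.card (State k N)) * (c * D) * n := by
        rw [Real.sqrt_mul (Nat.cast_nonneg _), Real.sqrt_sq (by positivity)]
        ring
    _ ≤ _ := by nlinarith

theorem isFeedback_exactControl {ρ : ℝ} (h0 : 0 ≤ ρ) (h1 : ρ ≤ 1) {β₀ : Control k N}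
    (hβ : G.IsFeedback β₀) : ∀ n, G.IsFeedback (G.exactControl ρ β₀ n)
  | 0 => hβ
  | n + 1 => by
    have ih := isFeedback_exactControl h0 h1 hβ n
    have hr := isFeedback_bestResponse ih
    exact ⟨fun t ht s => combo_mem_orthant (ih.1 t ht s) (hr.1 t ht s) h0 (sub_nonneg.2 h1),
      fun s => ((ih.2 s).const_smul ρ).add ((hr.2 s).const_smul (1 - ρ))⟩

theorem isFeedback_corruptedControl {ρ : ℝ} (h0 : 0 ≤ ρ) (h1 : ρ ≤ 1) {β₀ : Control k N}
    (hβ : G.IsFeedback β₀) {ε : ℕ → Control k N} (hε : ∀ n, 1 ≤ n → G.IsError (ε n)) :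
    ∀ n, G.IsFeedback (G.corruptedControl ρ β₀ ε n)
  | 0 => hβ
  | n + 1 => by
    have ih := isFeedback_corruptedControl h0 h1 hβ hε n
    have hr := isFeedback_bestResponse ih
    have he := hε (n + 1) n.succ_pos
    exact ⟨fun t ht s => combo_mem_orthant (ih.1 t ht s)
        (fun j => add_nonneg (hr.1 t ht s j) (he.1 t ht s j)) h0 (sub_nonneg.2 h1),
      fun s => ((ih.2 s).const_smul ρ).add (((hr.2 s).add (he.2 s)).const_smul (1 - ρ))⟩

theorem controlDev_zero (ρ : ℝ) (β₀ : Control k N) (ε : ℕ → Control k N) (t : ℝ) :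
    G.controlDev ρ β₀ ε 0 t = 0 := by
  simp [controlDev, exactControl, corruptedControl, sqNorm]

/-- Convexity of the square, then (‖a‖ + ‖e‖)² ≤ 2(‖a‖² + ‖e‖²); this is the source of the factor 2
in `cHat`. -/
theorem norm_combo_sq_le {E : Type*} [NormedAddCommGroup E] [NormedSpace ℝ E] {ρ : ℝ}
    (h0 : 0 ≤ ρ) (h1 : ρ ≤ 1) (x a e : E) :
    ‖ρ • x + (1 - ρ) • (a + e)‖ ^ 2 ≤ ρ * ‖x‖ ^ 2 + 2 * (1 - ρ) * (‖a‖ ^ 2 + ‖e‖ ^ 2) := by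
  have h2 : 0 ≤ 1 - ρ := sub_nonneg.2 h1
  have h3 : ‖ρ • x + (1 - ρ) • (a + e)‖ ≤ ρ * ‖x‖ + (1 - ρ) * (‖a‖ + ‖e‖) := by
    refine (norm_add_le _ _).trans ?_
    rw [norm_smul, norm_smul, Real.norm_of_nonneg h0, Real.norm_of_nonneg h2]
    gcongr
    exact norm_add_le _ _
  refine (pow_le_pow_left₀ (norm_nonneg _) h3 2).trans ?_
  nlinarith [mul_nonneg (mul_nonneg h0 h2) (sq_nonneg (‖x‖ - (‖a‖ + ‖e‖))),
    mul_nonneg h2 (sq_nonneg (‖a‖ - ‖e‖))]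

theorem controlDev_succ_le {c₀ ρ : ℝ} (h0 : 0 ≤ ρ) (h1 : ρ ≤ 1)
    (hresp : ∀ (β β' : Control k N) (t : ℝ),
      norm2 (fun s => G.bestResponse β t s - G.bestResponse β' t s)
        ≤ c₀ * norm2 (fun s => G.value β t s - G.value β' t s))
    (β₀ : Control k N) {ε : ℕ → Control k N} (n : ℕ) (hε : G.IsError (ε (n + 1))) {t : ℝ}
    (ht : t ∈ Icc 0 G.T) :
    G.controlDev ρ β₀ ε (n + 1) t ≤ ρ * G.controlDev ρ β₀ ε n t +
      cHat c₀ ρ * (G.valueDev ρ β₀ ε (n + 1) t + sNorm G.T (ε (n + 1)) ^ 2) := by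
  set b := G.corruptedControl ρ β₀ ε n with hb
  set a := G.exactControl ρ β₀ n with ha
  have hs : ∀ s, G.corruptedControl ρ β₀ ε (n + 1) t s - G.exactControl ρ β₀ (n + 1) t s
      = ρ • (b t s - a t s)
        + (1 - ρ) • ((G.bestResponse b t s - G.bestResponse a t s) + ε (n + 1) t s) := fun s => by
    simp only [corruptedControl, exactControl, ← ha, ← hb]
    module
  -- The values of index n + 1 belong to the controls of index n.
  have hq : G.valueDev ρ β₀ ε (n + 1) t = sqNorm (fun s => G.value b t s - G.value a t s) := rfl
  have h2 : sqNorm (fun s => G.bestResponse b t s - G.bestResponse a t s)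
      ≤ c₀ ^ 2 * G.valueDev ρ β₀ ε (n + 1) t := by
    rw [hq, ← norm2_sq, ← norm2_sq, ← mul_pow]
    exact pow_le_pow_left₀ (norm2_nonneg _) (hresp b a t) 2
  have h3 : sqNorm (ε (n + 1) t) ≤ sNorm G.T (ε (n + 1)) ^ 2 := by
    rw [← norm2_sq]
    exact pow_le_pow_left₀ (norm2_nonneg _) (norm2_le_sNorm hε.2 ht) 2
  have h4 : G.controlDev ρ β₀ ε (n + 1) t ≤ ρ * G.controlDev ρ β₀ ε n t + 2 * (1 - ρ) *
      (sqNorm (fun s => G.bestResponse b t s - G.bestResponse a t s) + sqNorm (ε (n + 1) t)) := by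
    simp only [controlDev, sqNorm, hs, ← ha, ← hb]
    rw [← Finset.sum_add_distrib, Finset.mul_sum, Finset.mul_sum, ← Finset.sum_add_distrib]
    exact Finset.sum_le_sum fun s _ => norm_combo_sq_le h0 h1 _ _ _
  refine h4.trans ?_
  unfold cHat
  rw [mul_assoc (2 * (1 - ρ))]
  have hq0 : 0 ≤ G.valueDev ρ β₀ ε (n + 1) t := sqNorm_nonneg _
  have h5 := mul_le_mul_of_nonneg_right (le_max_left (c₀ ^ 2) 1) hq0
  have h6 := mul_le_mul_of_nonneg_right (le_max_right (c₀ ^ 2) 1) (sq_nonneg (sNorm G.T (ε (n + 1))))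
  have h7 : 0 ≤ 2 * (1 - ρ) := by linarith
  gcongr
  linarith

/-! ### Bounds along the iteration: the explicit sums and the uniform estimate. -/

section Convergence

variable {c₀ cs ρ : ℝ} {β₀ : Control k N} {ε : ℕ → Control k N}

theorem continuousOn_controlDev (h0 : 0 ≤ ρ) (h1 : ρ ≤ 1) (hβ : G.IsFeedback β₀)
    (hε : ∀ n, 1 ≤ n → G.IsError (ε n)) (n : ℕ) :
    ContinuousOn (G.controlDev ρ β₀ ε n) (Icc 0 G.T) :=
  continuousOn_sqNorm fun s => ((isFeedback_corruptedControl h0 h1 hβ hε n).2 s).sub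
    ((isFeedback_exactControl h0 h1 hβ n).2 s)

theorem valueDev_succ_le (h0 : 0 ≤ ρ) (h1 : ρ ≤ 1) (hcs : 0 ≤ cs)
    (hval : ∀ β β' : Control k N, G.IsFeedback β → G.IsFeedback β' → ∀ t ∈ Icc 0 G.T,
      sqNorm (fun s => G.value β t s - G.value β' t s)
        ≤ cs * ∫ u in t..G.T, sqNorm (fun s => β' u s - β u s))
    (hβ : G.IsFeedback β₀) (hε : ∀ n, 1 ≤ n → G.IsError (ε n)) {n : ℕ} {t : ℝ}
    (ht : t ∈ Icc 0 G.T) {B : ℝ → ℝ} (hB : Continuous B)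
    (h : ∀ u ∈ Icc 0 G.T, G.controlDev ρ β₀ ε n u ≤ B u) :
    G.valueDev ρ β₀ ε (n + 1) t ≤ cs * ∫ u in t..G.T, B u := by
  have h2 := hval _ _ (isFeedback_corruptedControl h0 h1 hβ hε n)
    (isFeedback_exactControl h0 h1 hβ n) t ht
  refine LE.le.trans h2 (mul_le_mul_of_nonneg_left ?_ hcs)
  have hsub : Icc t G.T ⊆ Icc 0 G.T := Icc_subset_Icc_left ht.1
  have hsymm : (fun u => sqNorm (fun s => G.exactControl ρ β₀ n u s
      - G.corruptedControl ρ β₀ ε n u s)) = G.controlDev ρ β₀ ε n := by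
    ext u
    simp only [controlDev, sqNorm, norm_sub_rev]
  rw [hsymm]
  exact intervalIntegral.integral_mono_on ht.2
    (((continuousOn_controlDev h0 h1 hβ hε n).mono hsub).intervalIntegrable_of_Icc ht.2)
    (hB.intervalIntegrable _ _) fun u hu => h u (hsub hu)

theorem controlDev_le_gammaBound (h0 : 0 ≤ ρ) (h1 : ρ < 1) (hcs : 0 ≤ cs)
    (hresp : ∀ (β β' : Control k N) (t : ℝ),
      norm2 (fun s => G.bestResponse β t s - G.bestResponse β' t s)
        ≤ c₀ * norm2 (fun s => G.value β t s - G.value β' t s))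
    (hval : ∀ β β' : Control k N, G.IsFeedback β → G.IsFeedback β' → ∀ t ∈ Icc 0 G.T,
      sqNorm (fun s => G.value β t s - G.value β' t s)
        ≤ cs * ∫ u in t..G.T, sqNorm (fun s => β' u s - β u s))
    (hβ : G.IsFeedback β₀) (hε : ∀ n, 1 ≤ n → G.IsError (ε n)) (n : ℕ) :
    ∀ t ∈ Icc 0 G.T, G.controlDev ρ β₀ ε n t
      ≤ gammaBound G.T c₀ cs ρ (fun m => sNorm G.T (ε m)) n t := by
  induction n with
  | zero =>
    intro t _
    rw [controlDev_zero, gammaBound_eq]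
    simp
  | succ n ih =>
    intro t ht
    refine (controlDev_succ_le h0 h1.le hresp β₀ n (hε _ n.succ_pos) ht).trans ?_
    have h2 := valueDev_succ_le h0 h1.le hcs hval hβ hε ht
      (continuous_gammaBound G.T c₀ cs ρ (fun m => sNorm G.T (ε m)) n) ih
    rw [integral_gammaBound] at h2
    rw [gammaBound_succ]
    have := (cHat_pos h1 c₀).le
    gcongr
    exact ih t ht

theorem integral_exp_mul_sub {K : ℝ} (hK : K ≠ 0) (t T : ℝ) :
    ∫ u in t..T, Real.exp (K * (T - u)) = (Real.exp (K * (T - t)) - 1) / K := by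
  have hd : ∀ u ∈ uIcc t T,
      HasDerivAt (fun u => -(Real.exp (K * (T - u)) / K)) (Real.exp (K * (T - u))) u := by
    intro u _
    have h1 : HasDerivAt (fun u => K * (T - u)) (K * (-1)) u :=
      ((hasDerivAt_id u).const_sub T).const_mul K
    refine ((h1.exp).div_const K).neg.congr_deriv ?_
    field_simp
  rw [intervalIntegral.integral_eq_sub_of_hasDerivAt hd
    (Continuous.intervalIntegrable (by fun_prop) _ _)]
  simp only [sub_self, mul_zero, Real.exp_zero]
  ring

/-- The control deviations are bounded, uniformly in the iteration, when the errors are. -/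
theorem controlDev_le_exp (h0 : 0 ≤ ρ) (h1 : ρ < 1) (hcs : 0 < cs)
    (hresp : ∀ (β β' : Control k N) (t : ℝ),
      norm2 (fun s => G.bestResponse β t s - G.bestResponse β' t s)
        ≤ c₀ * norm2 (fun s => G.value β t s - G.value β' t s))
    (hval : ∀ β β' : Control k N, G.IsFeedback β → G.IsFeedback β' → ∀ t ∈ Icc 0 G.T,
      sqNorm (fun s => G.value β t s - G.value β' t s)
        ≤ cs * ∫ u in t..G.T, sqNorm (fun s => β' u s - β u s))
    (hβ : G.IsFeedback β₀) (hε : ∀ n, 1 ≤ n → G.IsError (ε n)) {E : ℝ}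
    (hE : ∀ n, 1 ≤ n → sNorm G.T (ε n) ^ 2 ≤ E) (n : ℕ) :
    ∀ t ∈ Icc 0 G.T, G.controlDev ρ β₀ ε n t ≤
        cHat c₀ ρ / (1 - ρ) * E * Real.exp (cs * cHat c₀ ρ / (1 - ρ) * (G.T - t)) ∧
      G.valueDev ρ β₀ ε (n + 1) t ≤
        E * (Real.exp (cs * cHat c₀ ρ / (1 - ρ) * (G.T - t)) - 1) := by
  have hρ : 0 < 1 - ρ := sub_pos.2 h1
  have hc := cHat_pos h1 c₀
  have hE0 : 0 ≤ E := (sq_nonneg _).trans (hE 1 le_rfl)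
  set c := cHat c₀ ρ
  set K := cs * c / (1 - ρ) with hK_def
  have hK : 0 < K := by positivity
  have hstep : ∀ n, (∀ t ∈ Icc 0 G.T,
      G.controlDev ρ β₀ ε n t ≤ c / (1 - ρ) * E * Real.exp (K * (G.T - t))) → ∀ t ∈ Icc 0 G.T,
      G.valueDev ρ β₀ ε (n + 1) t ≤ E * (Real.exp (K * (G.T - t)) - 1) := by
    intro n hn t ht
    have h2 := valueDev_succ_le h0 h1.le hcs.le hval hβ hε ht (by fun_prop) hn
    rw [intervalIntegral.integral_const_mul, integral_exp_mul_sub hK.ne'] at h2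
    refine h2.trans_eq ?_
    rw [hK_def]
    field_simp
  have hmain : ∀ t ∈ Icc 0 G.T,
      G.controlDev ρ β₀ ε n t ≤ c / (1 - ρ) * E * Real.exp (K * (G.T - t)) := by
    induction n with
    | zero =>
      intro t _
      rw [controlDev_zero]
      positivity
    | succ n ih =>
      intro t ht
      refine (controlDev_succ_le h0 h1.le hresp β₀ n (hε _ n.succ_pos) ht).trans ?_
      have h2 := hstep n ih t ht
      have h3 := hE (n + 1) n.succ_pos
      set x := Real.exp (K * (G.T - t))
      calc _ ≤ ρ * (c / (1 - ρ) * E * x) + c * (E * (x - 1) + E) := by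
            gcongr
            exact ih t ht
        -- The constant A = c E / (1 - ρ) solves ρ A + c E = A, so the majorant is reproduced
        -- exactly; the -1 in the value bound absorbs the new error.
        _ = c / (1 - ρ) * E * x := by
            field_simp
            ring
  exact fun t ht => ⟨hmain t ht, hstep n hmain t ht⟩

theorem supNorm_le {T : ℝ} {f : ℝ → ℝ} {B : ℝ} (h0 : ∀ t ∈ Icc 0 T, 0 ≤ f t)
    (h : ∀ t ∈ Icc 0 T, f t ≤ B) : supNorm T f ≤ ENNReal.ofReal B :=
  iSup₂_le fun t ht => ENNReal.ofReal_le_ofReal (by rw [abs_of_nonneg (h0 t ht)]; exact h t ht)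

/-- The deviations are dominated by the errors, uniformly in the iteration. -/
theorem iSup_supNorm_le (h0 : 0 ≤ ρ) (h1 : ρ < 1) (hcs : 0 < cs)
    (hresp : ∀ (β β' : Control k N) (t : ℝ),
      norm2 (fun s => G.bestResponse β t s - G.bestResponse β' t s)
        ≤ c₀ * norm2 (fun s => G.value β t s - G.value β' t s))
    (hval : ∀ β β' : Control k N, G.IsFeedback β → G.IsFeedback β' → ∀ t ∈ Icc 0 G.T,
      sqNorm (fun s => G.value β t s - G.value β' t s)
        ≤ cs * ∫ u in t..G.T, sqNorm (fun s => β' u s - β u s))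
    (hβ : G.IsFeedback β₀) (hε : ∀ n, 1 ≤ n → G.IsError (ε n)) :
    (⨆ n : ℕ, ⨆ _ : 1 ≤ n, (supNorm G.T (G.controlDev ρ β₀ ε n) +
        supNorm G.T (G.valueDev ρ β₀ ε n))) ≤
      ENNReal.ofReal ((cHat c₀ ρ / (1 - ρ) + 1) *
          Real.exp (cs * cHat c₀ ρ / (1 - ρ) * G.T)) *
        ⨆ n : ℕ, ⨆ _ : 1 ≤ n, ENNReal.ofReal (sNorm G.T (ε n) ^ 2) := by
  have hρ : 0 < 1 - ρ := sub_pos.2 h1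
  have hc := cHat_pos h1 c₀
  set S := ⨆ n : ℕ, ⨆ _ : 1 ≤ n, ENNReal.ofReal (sNorm G.T (ε n) ^ 2) with hS
  set c := cHat c₀ ρ
  set K := cs * c / (1 - ρ)
  have hK : 0 ≤ K := by positivity
  have hx0 : 0 < Real.exp (K * G.T) := Real.exp_pos _
  have hct : 0 < (c / (1 - ρ) + 1) * Real.exp (K * G.T) := by positivity
  -- With unbounded errors the right-hand side is infinite, because the constant is positive.
  rcases eq_or_ne S ⊤ with htop | htop
  · rw [htop, ENNReal.mul_top (ENNReal.ofReal_pos.2 hct).ne']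
    exact le_top
  have hE : ∀ n, 1 ≤ n → sNorm G.T (ε n) ^ 2 ≤ S.toReal := fun n hn =>
    (ENNReal.ofReal_le_iff_le_toReal htop).1
      (le_iSup₂_of_le (f := fun n (_ : 1 ≤ n) => ENNReal.ofReal (sNorm G.T (ε n) ^ 2)) n hn le_rfl)
  have hS0 : 0 ≤ S.toReal := ENNReal.toReal_nonneg
  have hbd := controlDev_le_exp h0 h1 hcs hresp hval hβ hε hE
  have hexp : ∀ t ∈ Icc 0 G.T, Real.exp (K * (G.T - t)) ≤ Real.exp (K * G.T) := fun t ht =>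
    Real.exp_le_exp.2 (mul_le_mul_of_nonneg_left (by linarith [ht.1]) hK)
  refine iSup₂_le fun n hn => ?_
  have hγ : supNorm G.T (G.controlDev ρ β₀ ε n)
      ≤ ENNReal.ofReal (c / (1 - ρ) * S.toReal * Real.exp (K * G.T)) :=
    supNorm_le (fun t _ => sqNorm_nonneg _) fun t ht => (hbd n t ht).1.trans
      (mul_le_mul_of_nonneg_left (hexp t ht) (by positivity))
  have hq : supNorm G.T (G.valueDev ρ β₀ ε n)
      ≤ ENNReal.ofReal (S.toReal * Real.exp (K * G.T)) := by
    obtain ⟨m, rfl⟩ := Nat.exists_eq_add_of_le' hn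
    exact supNorm_le (fun t _ => sqNorm_nonneg _) fun t ht => (hbd m t ht).2.trans
      (mul_le_mul_of_nonneg_left (by linarith [hexp t ht]) hS0)
  calc _ ≤ _ := add_le_add hγ hq
    _ = ENNReal.ofReal ((c / (1 - ρ) + 1) * Real.exp (K * G.T)) * ENNReal.ofReal S.toReal := by
        rw [← ENNReal.ofReal_add (by positivity) (by positivity), ← ENNReal.ofReal_mul hct.le]
        congr 1
        ring
    _ = _ := by rw [ENNReal.ofReal_toReal htop]

end Convergence

end Game

end PicardGame

/-! ### The main theorem. -/

theorem theorem5p1 (k N : ℕ) (hN : 0 < N) (G : PicardGame.Game k N) :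
    ∃ c₀ : ℝ, 0 < c₀ ∧ G.ResponseBound c₀ ∧
    ∀ ca : ℝ, 0 < ca → ∃ cs : ℝ, 0 < cs ∧ G.ValueBound ca cs ∧
    ∀ ρ : ℝ, 0 < ρ → ρ < 1 → ∃ ct : ℝ, 0 < ct ∧
    ∀ β₀ ∈ G.admissibleBounded ca,
    ∀ ε : ℕ → PicardGame.Control k N, (∀ n, 1 ≤ n → G.IsError (ε n)) →
      (∀ n : ℕ, 2 ≤ n → ∀ t ∈ Set.Icc 0 G.T,
        G.controlDev ρ β₀ ε (n - 1) t ≤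
          PicardGame.gammaBound G.T c₀ cs ρ (fun m => PicardGame.sNorm G.T (ε m)) (n - 1) t ∧
        G.valueDev ρ β₀ ε n t ≤
          PicardGame.valueBound G.T c₀ cs ρ (fun m => PicardGame.sNorm G.T (ε m)) n t) ∧
      (⨆ n : ℕ, ⨆ _ : 1 ≤ n, (PicardGame.supNorm G.T (G.controlDev ρ β₀ ε n) +
          PicardGame.supNorm G.T (G.valueDev ρ β₀ ε n))) ≤
        ENNReal.ofReal ct *
          ⨆ n : ℕ, ⨆ _ : 1 ≤ n, ENNReal.ofReal (PicardGame.sNorm G.T (ε n) ^ 2) := by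
  open PicardGame PicardGame.Game in
  obtain ⟨c₀, hc₀, hresp⟩ := G.exists_response_lipschitz
  refine ⟨c₀, hc₀, fun β _ β' _ t _ => hresp β β' t, fun ca _ => ?_⟩
  have hA : 0 ≤ Fintype.card (State k N) * (G.valueLip ^ 2 * G.T) := by
    have := G.T_pos
    positivity
  -- The added 1 keeps `cs` positive even when `valueLip` vanishes.
  set cs : ℝ := Fintype.card (State k N) * (G.valueLip ^ 2 * G.T) + 1
  have hcs : 0 < cs := by linarith
  have hval : ∀ β β' : Control k N, G.IsFeedback β → G.IsFeedback β' → ∀ t ∈ Set.Icc 0 G.T,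
      sqNorm (fun s => G.value β t s - G.value β' t s)
        ≤ cs * ∫ u in t..G.T, sqNorm (fun s => β' u s - β u s) := fun β β' hβ hβ' t ht =>
    (sqNorm_value_sub_le hβ hβ' ht).trans (mul_le_mul_of_nonneg_right (by linarith)
      (intervalIntegral.integral_nonneg ht.2 fun u _ => sqNorm_nonneg _))
  refine ⟨cs, hcs, fun β hβ β' hβ' => hval β β' (isFeedback_of_admissible hβ.1)
    (isFeedback_of_admissible hβ'.1), fun ρ hρ0 hρ1 => ?_⟩
  have hρ : 0 < 1 - ρ := sub_pos.2 hρ1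
  have hc := cHat_pos hρ1 c₀
  refine ⟨(cHat c₀ ρ / (1 - ρ) + 1) * Real.exp (cs * cHat c₀ ρ / (1 - ρ) * G.T), by positivity,
    fun β₀ hβ₀ ε hε => ?_⟩
  have hβ := isFeedback_of_admissible hβ₀.1
  have hγ := controlDev_le_gammaBound hρ0.le hρ1 hcs.le hresp hval hβ hε
  refine ⟨fun n hn t ht => ⟨hγ (n - 1) t ht, ?_⟩,
    iSup_supNorm_le hρ0.le hρ1 hcs hresp hval hβ hε⟩
  obtain ⟨m, rfl⟩ := Nat.exists_eq_add_of_le' (one_le_two.trans hn)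
  rw [← integral_gammaBound]
  exact valueDev_succ_le hρ0.le hρ1.le hcs.le hval hβ hε ht
    (continuous_gammaBound G.T c₀ cs ρ _ m) (hγ m)
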